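/- Let $(G,P)$ be a weak quasi-lattice ordered group: $G$ is a group and $P\subseteq G$ is a submonoid with $P\cap P^{-1}=\{e\}$ such that any $p,q\in P$ with $pP\cap qP\neq\emptyset$ have a (unique) least common right multiple $p\vee q\in P$, i.e. $pP\cap qP=(p\vee q)P$. For a finite set $K\subseteq P$ let $\vee K\in P$ denote its least common right multiple if it has one, and write $\vee K=\infty$ otherwise. Assume that $P$ is Noetherian, i.e. there is no infinite sequence $(p_n)$ in $P$ such that each $p_{n+1}$ is a proper factor of $p_n$ (meaning $p_n=g\,p_{n+1}h$ with $g,h\in P$ not both invertible in $P$). Let $P_{\mathrm{inf}}$ be the smallest subset of $P$ that contains all atoms of $P$ and contains $x^{-1}(x\vee p)$ whenever it contains $p$, $x$ is an atom and $x\vee p\ne\infty$. Let $A$ be a $C^*$-algebra, $X=\{X_p\}_{p\in P}$ a compactly aligned product system over $P$ of essential $C^*$-correspondences over $A$ with $X_e=A$, $N:P\to(0,\infty)$ a multiplicative homomorphism, and $\beta\in\mathbb R$. For a tracial state $\tau$ on $A$, $p\in P$ and $a\in A_+$ let $$\operatorname{Tr}_\tau^p(a)=\sup_H\sum_{\xi\in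 H}\tau(\langle\xi,a\xi\rangle)\in[0,\infty],$$ the supremum being over the finite subsets $H\subseteq X_p$ with $\sum_{\xi\in H}\theta_{\xi,\xi}\le 1$, where $\theta_{\xi,\zeta}\eta=\xi\langle\zeta,\eta\rangle$. Then a tracial state $\tau$ on $A$ satisfies $$\tau(a)+\sum_{\emptyset\neq K\subseteq J}(-1)^{|K|}N(\vee K)^{-\beta}\operatorname{Tr}_\tau^{\vee K}(a)\ \ge\ 0\qquad\text{for all }a\in A_+$$ for all finite $J\subseteq P\setminus\{e\}$ if and only if it satisfies this inequality for all finite $J\subseteq P_{\mathrm{inf}}$. Here the terms with $\vee K=\infty$ are zero, and the sums are taken in $[-\infty,\infty]$ with $\infty-\infty=-\infty$. -/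

import Mathlib

open scoped ComplexOrder

noncomputable section

/-! ### Monoids: right LCMs, Noetherianity, the minimal set

In a monoid, Mathlib's `p ∣ q` means `∃ c, q = p * c`: the element `p` is a left divisor of `q`,
i.e. `q` lies in the right ideal generated by `p`. -/

section Monoids

variable {M : Type*} [Monoid M]

/-- `r` is a least common right multiple of the set `U`. -/
def IsRightLCM (U : Set M) (r : M) : Prop :=
  (∀ u ∈ U, u ∣ r) ∧ ∀ r' : M, (∀ u ∈ U, u ∣ r') → r ∣ r'

/-- `p` is a proper factor of `q`. -/
def IsProperFactor (p q : M) : Prop :=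
  ∃ g h : M, q = g * p * h ∧ (¬ IsUnit g ∨ ¬ IsUnit h)

variable (M) in
/-- There is no infinite descending sequence for the proper factor relation. -/
def IsNoetherianMonoid : Prop :=
  ¬ ∃ f : ℕ → M, ∀ n, IsProperFactor (f (n + 1)) (f n)

/-- Membership in the minimal set: the smallest subset that contains the atoms
(irreducible elements) and is closed under `p ↦ x⁻¹ (x ∨ p)` for atoms `x`
such that `x ∨ p` exists.  The element `r` below is `x⁻¹ (x ∨ p)`. -/
inductive MemPInf : M → Prop
  | atom (s : M) : Irreducible s → MemPInf s
  | step (x p r : M) : Irreducible x → MemPInf p → IsRightLCM {x, p} (x * r) → MemPInf r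

variable (M) in
/-- The minimal set. -/
def PInf : Set M := {p | MemPInf p}

end Monoids

/-- `(G, P)` is a weak quasi-lattice ordered group. -/
structure IsWeakQuasiLatticeOrdered {G : Type*} [Group G] (P : Submonoid G) : Prop where
  inter_inv : ∀ g : G, g ∈ P → g⁻¹ ∈ P → g = 1
  exists_lcm : ∀ p q : P, (∃ r : P, p ∣ r ∧ q ∣ r) → ∃ r : P, IsRightLCM {p, q} r

/-! ### Hilbert modules and correspondences -/

/-- A right Hilbert module over a (possibly non-unital) C*-algebra, with inner product `ip` linear
in the second variable.  (Mathlib's `CStarModule` is about left modules.) -/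
class RightHilbertModule (A E : Type*) [NonUnitalCStarAlgebra A] [PartialOrder A]
    [NormedAddCommGroup E] [NormedSpace ℂ E] [CompleteSpace E] where
  ip : E → E → A
  /-- the right action, `ract x a = x a` -/
  ract : E →ₗ[ℂ] A →ₗ[ℂ] E
  ract_mul : ∀ (x : E) (a b : A), ract x (a * b) = ract (ract x a) b
  ip_add_right : ∀ x y z : E, ip x (y + z) = ip x y + ip x z
  ip_smul_right : ∀ (c : ℂ) (x y : E), ip x (c • y) = c • ip x y
  ip_ract_right : ∀ (x y : E) (a : A), ip x (ract y a) = ip x y * a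
  star_ip : ∀ x y : E, star (ip x y) = ip y x
  ip_self_nonneg : ∀ x : E, 0 ≤ ip x x
  norm_sq_eq : ∀ x : E, ‖x‖ ^ 2 = ‖ip x x‖

/-- A C*-correspondence over `A`: a right Hilbert `A`-module with a left action of `A` by
a *-homomorphism into the adjointable operators. -/
class CStarCorrespondence (A E : Type*) [NonUnitalCStarAlgebra A] [PartialOrder A]
    [NormedAddCommGroup E] [NormedSpace ℂ E] [CompleteSpace E]
    extends RightHilbertModule A E where
  /-- the left action, `lact a x = φ(a) x` -/
  lact : A →ₗ[ℂ] E →ₗ[ℂ] E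
  lact_mul : ∀ (a b : A) (x : E), lact (a * b) x = lact a (lact b x)
  ip_lact_left : ∀ (a : A) (x y : E), ip (lact a x) y = ip x (lact (star a) y)

open RightHilbertModule CStarCorrespondence

section Modules

variable (A : Type*) [NonUnitalCStarAlgebra A] [PartialOrder A]
  {E : Type*} [NormedAddCommGroup E] [NormedSpace ℂ E] [CompleteSpace E]

/-- The operator `θ_{ξ,ζ} η = ξ ⟨ζ, η⟩`. -/
def theta [RightHilbertModule A E] (ξ ζ η : E) : E := ract ξ (ip ζ η : A)

/-- `T` is adjointable. -/
def IsAdjointable [RightHilbertModule A E] (T : E → E) : Prop :=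
  ∃ S : E → E, ∀ x y : E, (ip (T x) y : A) = ip x (S y)

variable (E) in
/-- The generalised compact operators: the norm closure of the linear span of the `θ_{ξ,ζ}`. -/
def compactOps [RightHilbertModule A E] : Submodule ℂ (E →L[ℂ] E) :=
  (Submodule.span ℂ {T : E →L[ℂ] E | ∃ ξ ζ : E, ∀ η, T η = theta A ξ ζ η}).topologicalClosure

/-- The order of operators on a Hilbert module: `S - T` is positive, that is,
`⟨η, T η⟩ ≤ ⟨η, S η⟩` for all `η`. -/
def OpLE [RightHilbertModule A E] (T S : E → E) : Prop :=
  ∀ η : E, (ip η (T η) : A) ≤ ip η (S η)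

variable (E) in
/-- The correspondence is essential: `φ(A) E` spans a dense subspace. -/
def IsEssential [CStarCorrespondence A E] : Prop :=
  Dense (Submodule.span ℂ {y : E | ∃ (a : A) (x : E), y = lact a x} : Set E)

variable {A} in
/-- The trace `Tr_τ(T) = sup_H ∑_{ξ ∈ H} τ(⟨ξ, T ξ⟩)` induced from `τ`, for positive `T`;
the supremum is over the finite sets `H` with `∑_{ξ ∈ H} θ_{ξ,ξ} ≤ 1`. -/
def inducedTrace [RightHilbertModule A E] (τ : A →L[ℂ] ℂ) (T : E → E) : ENNReal :=
  ⨆ H : {H : Finset E // OpLE A (fun η => ∑ ξ ∈ H, theta A ξ ξ η) (fun η => η)},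
    ENNReal.ofReal (∑ ξ ∈ H.1, (τ (ip ξ (T ξ))).re)

/-- The bilinear map `m : E × F → Y` extends to an isometric isomorphism of the internal tensor
product `E ⊗_A F`, whose inner product is `⟨ξ ⊗ ζ, ξ' ⊗ ζ'⟩ = ⟨ζ, φ(⟨ξ, ξ'⟩) ζ'⟩`, onto `Y`. -/
structure IsInternalTensor {F Y : Type*}
    [NormedAddCommGroup F] [NormedSpace ℂ F] [CompleteSpace F]
    [NormedAddCommGroup Y] [NormedSpace ℂ Y] [CompleteSpace Y]
    [CStarCorrespondence A E] [CStarCorrespondence A F] [CStarCorrespondence A Y]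
    (m : E →ₗ[ℂ] F →ₗ[ℂ] Y) : Prop where
  ip_eq : ∀ (ξ ξ' : E) (ζ ζ' : F),
    (ip (m ξ ζ) (m ξ' ζ') : A) = ip ζ (lact (ip ξ ξ' : A) ζ')
  dense_span : Dense (Submodule.span ℂ {y : Y | ∃ (ξ : E) (ζ : F), y = m ξ ζ} : Set Y)

end Modules

/-- `τ` is a tracial state. -/
structure IsTracialState {A : Type*} [NonUnitalCStarAlgebra A] [PartialOrder A]
    (τ : A →L[ℂ] ℂ) : Prop where
  nonneg : ∀ a : A, 0 ≤ a → 0 ≤ τ a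
  norm_eq_one : ‖τ‖ = 1
  tracial : ∀ a b : A, τ (a * b) = τ (b * a)

/-! ### Product systems -/

section ProductSystems

variable (A : Type*) [NonUnitalCStarAlgebra A] [PartialOrder A]
  {M : Type*} [Monoid M]
  (X : M → Type*) [∀ p, NormedAddCommGroup (X p)] [∀ p, NormedSpace ℂ (X p)]
  [∀ p, CompleteSpace (X p)] [∀ p, CStarCorrespondence A (X p)]

/-- A product system structure on the family `X` of correspondences over `A`, indexed by
a monoid.  The product `X_p × X_q → X_r` is indexed by the proof of `p q = r`, so that no
transport between fibres is needed. -/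
structure ProductSystem where
  mul : ∀ {p q r : M}, p * q = r → (X p →ₗ[ℂ] X q →ₗ[ℂ] X r)
  mul_assoc : ∀ {p q r pq qr s : M} (h₁ : p * q = pq) (h₂ : pq * r = s)
    (h₃ : q * r = qr) (h₄ : p * qr = s) (x : X p) (y : X q) (z : X r),
    mul h₂ (mul h₁ x y) z = mul h₄ x (mul h₃ y z)
  isTensor : ∀ {p q r : M} (h : p * q = r), p ≠ 1 → IsInternalTensor A (mul h)
  /-- the identification of `X_e` with the canonical correspondence `A` over `A` -/
  unit : A ≃ₗ[ℂ] X 1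
  ip_unit : ∀ a b : A, ip (unit a) (unit b) = star a * b
  ract_unit : ∀ a b : A, ract (unit a) b = unit (a * b)
  lact_unit : ∀ a b : A, lact a (unit b) = unit (a * b)
  unit_mul : ∀ (p : M) (a : A) (x : X p), mul (one_mul p) (unit a) x = lact a x
  mul_unit : ∀ (p : M) (x : X p) (a : A), mul (mul_one p) x (unit a) = ract x a

variable {A X}

/-- `S' = ι_p^r(S)`, i.e. `S' = S ⊗ I` on `X_r = X_p ⊗_A X_s`, where `r = p s`.  Such an `S'` is
unique, the products being total in `X_r`. -/
def ProductSystem.IsAmplification (Y : ProductSystem A X) {p s r : M} (h : p * s = r)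
    (S : X p →L[ℂ] X p) (S' : X r →L[ℂ] X r) : Prop :=
  IsAdjointable A S' ∧ ∀ (ξ : X p) (ζ : X s), S' (Y.mul h ξ ζ) = Y.mul h (S ξ) ζ

/-- `ι_p^r(K(X_p)) ι_q^r(K(X_q)) ⊆ K(X_r)` whenever `r = p ∨ q` (here `r = p s = q t`). -/
def ProductSystem.IsCompactlyAligned (Y : ProductSystem A X) : Prop :=
  ∀ (p q r s t : M) (hs : p * s = r) (ht : q * t = r), IsRightLCM {p, q} r →
    ∀ S ∈ compactOps A (X p), ∀ T ∈ compactOps A (X q), ∀ S' T' : X r →L[ℂ] X r,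
      Y.IsAmplification hs S S' → Y.IsAmplification ht T T' →
        S'.comp T' ∈ compactOps A (X r)

/-! ### The positivity condition -/

open Classical in
variable (X) in
/-- `N(∨K)^{-β} Tr_τ^{∨K}(a)`, read as `0` when `∨K = ∞`. -/
def joinTerm (N : M →* ℝ) (β : ℝ) (τ : A →L[ℂ] ℂ) (a : A) (K : Finset M) : ENNReal :=
  if h : ∃ r : M, IsRightLCM (K : Set M) r then
    ENNReal.ofReal (N h.choose ^ (-β)) *
      inducedTrace τ (fun ξ : X h.choose => lact a ξ)
  else 0

variable (X) in
/-- The expression `τ(a) + ∑_{∅ ≠ K ⊆ J} (-1)^{|K|} N(∨K)^{-β} Tr_τ^{∨K}(a)` for `a ≥ 0`.  Induced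
traces may be infinite a priori, so the sum is taken in the extended reals (`∞ - ∞` is `-∞`
there, so an infinite negative term makes the expression negative). -/
def positivitySum (N : M →* ℝ) (β : ℝ) (τ : A →L[ℂ] ℂ) (J : Finset M) (a : A) : EReal :=
  (((τ a).re : ℝ) : EReal) +
    ∑ K ∈ J.powerset with K.Nonempty, (-1 : EReal) ^ K.card * (joinTerm X N β τ a K : EReal)

variable (X) in
/-- The positivity condition for all finite subsets `J` of `R` and all `a ≥ 0`. -/
def PositivityOn (N : M →* ℝ) (β : ℝ) (τ : A →L[ℂ] ℂ) (R : Set M) : Prop :=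
  ∀ J : Finset M, (J : Set M) ⊆ R → ∀ a : A, 0 ≤ a → 0 ≤ positivitySum X N β τ J a

end ProductSystems

end

open RightHilbertModule CStarCorrespondence

open Filter Topology

section PhaseInvariance

variable {E : Type*} [NormedAddCommGroup E] [NormedSpace ℂ E]

/-- A function on a complex vector space that ignores unimodular factors. -/
def PhaseInvariant {B : Type*} [Zero B] (f : E → B) : Prop :=
  f 0 = 0 ∧ ∀ c : ℂ, ‖c‖ = 1 → ∀ x, f (c • x) = f x

theorem mul_star_self_of_norm_eq_one {c : ℂ} (hc : ‖c‖ = 1) : c * star c = 1 := by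
  have := Complex.mul_conj' c
  rw [hc] at this
  simpa using this

/-- Appending a vector to a finite set, up to a unimodular factor. -/
theorem exists_sum_eq_add_sum (B : Type*) [AddCommMonoid B] (H : Finset E) (ζ : E) :
    ∃ H' : Finset E, ∀ f : E → B, PhaseInvariant f →
      ∑ ξ ∈ H', f ξ = f ζ + ∑ ξ ∈ H, f ξ := by
  classical
  by_cases hζ : ζ = 0
  · exact ⟨H, fun f hf => by rw [hζ, hf.1, zero_add]⟩
  · have hinj : Function.Injective fun c : Circle => (c : ℂ) • ζ := fun c d h =>
      Circle.ext (smul_left_injective ℂ hζ h)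
    obtain ⟨c, hc⟩ : ∃ c : Circle, (c : ℂ) • ζ ∉ H := by
      by_contra! h
      have hexp : Function.Injective fun n : ℕ => Circle.exp (1 / ((n : ℝ) + 1)) := by
        intro m n hmn
        have harg : ∀ k : ℕ, Complex.arg (Circle.exp (1 / ((k : ℝ) + 1))) = 1 / ((k : ℝ) + 1) := by
          intro k
          have h0 : 0 < 1 / ((k : ℝ) + 1) := by positivity
          have h1 : 1 / ((k : ℝ) + 1) ≤ 1 := by
            rw [div_le_one (by positivity)]; linarith [(Nat.cast_nonneg k : (0 : ℝ) ≤ k)]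
          exact Circle.arg_exp (by linarith [Real.pi_pos]) (by linarith [Real.pi_gt_three])
        have h := congrArg (fun c : Circle => Complex.arg c) hmn
        simp only [harg] at h
        simpa using h
      exact Set.infinite_of_injective_forall_mem (hinj.comp hexp) (fun n => h _) H.finite_toSet
    refine ⟨insert ((c : ℂ) • ζ) H, fun f hf => ?_⟩
    rw [Finset.sum_insert hc, hf.2 c (Circle.norm_coe c)]

/-- A finite family of vectors can be replaced by a finite set, up to unimodular factors. -/
theorem exists_finset_sum_eq (B : Type*) [AddCommMonoid B] {ι : Type*} (s : Finset ι) (v : ι → E) :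
    ∃ H : Finset E, ∀ f : E → B, PhaseInvariant f → ∑ ξ ∈ H, f ξ = ∑ i ∈ s, f (v i) := by
  classical
  induction s using Finset.induction_on with
  | empty => exact ⟨∅, fun f _ => by simp⟩
  | insert i s hi ih =>
    obtain ⟨H, hH⟩ := ih
    obtain ⟨H', hH'⟩ := exists_sum_eq_add_sum B H (v i)
    exact ⟨H', fun f hf => by rw [hH' f hf, hH f hf, Finset.sum_insert hi]⟩

end PhaseInvariance

section FunctionalCalculus

variable {A : Type*} [NonUnitalCStarAlgebra A]

theorem cfcₙ_two_mul_sub {Γ : A} (hΓ : IsSelfAdjoint Γ) {f : ℝ → ℝ} (hf : Continuous f)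
    (hf0 : f 0 = 0) : cfcₙ (fun t => f t + f t - f t * t * f t) Γ =
      cfcₙ f Γ + cfcₙ f Γ - cfcₙ f Γ * Γ * cfcₙ f Γ := by
  have hid : cfcₙ (fun t : ℝ => t) Γ = Γ := cfcₙ_id' ℝ Γ
  have h1 : cfcₙ (fun t => f t * t) Γ = cfcₙ f Γ * Γ := by
    rw [cfcₙ_mul f (fun t => t) Γ hf.continuousOn hf0 continuousOn_id rfl, hid]
  have c1 : Continuous fun t => f t * t := by fun_prop
  have h2 : cfcₙ (fun t => f t * t * f t) Γ = cfcₙ f Γ * Γ * cfcₙ f Γ := by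
    rw [cfcₙ_mul (fun t => f t * t) f Γ c1.continuousOn (by simp) hf.continuousOn hf0, h1]
  have c2 : Continuous fun t => f t * t * f t := by fun_prop
  have c3 : Continuous fun t => f t + f t := by fun_prop
  rw [cfcₙ_sub (fun t => f t + f t) (fun t => f t * t * f t) Γ c3.continuousOn (by simp [hf0])
    c2.continuousOn (by simp), h2, cfcₙ_add f f Γ hf.continuousOn hf0 hf.continuousOn hf0]

theorem cfcₙ_mul_one_sub_sq {Γ : A} (hΓ : IsSelfAdjoint Γ) {f : ℝ → ℝ} (hf : Continuous f)
    (hf0 : f 0 = 0) :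
    cfcₙ (fun t => t - t * (f t + f t - f t * t * f t) * t) Γ =
      Γ - Γ * (cfcₙ f Γ + cfcₙ f Γ - cfcₙ f Γ * Γ * cfcₙ f Γ) * Γ := by
  have hid : cfcₙ (fun t : ℝ => t) Γ = Γ := cfcₙ_id' ℝ Γ
  have c0 : Continuous fun t => f t + f t - f t * t * f t := by fun_prop
  have h0 := cfcₙ_two_mul_sub hΓ hf hf0
  generalize hk : (fun t => f t + f t - f t * t * f t) = k at c0 h0
  have hk0 : k 0 = 0 := by simp [← hk, hf0]
  have hk' : (fun t => t - t * (f t + f t - f t * t * f t) * t) = fun t => t - t * k t * t := by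
    rw [← hk]
  have h1 : cfcₙ (fun t => t * k t) Γ = Γ * cfcₙ k Γ := by
    rw [cfcₙ_mul (fun t => t) k Γ continuousOn_id rfl c0.continuousOn hk0, hid]
  have c1 : Continuous fun t => t * k t := by fun_prop
  have h2 : cfcₙ (fun t => t * k t * t) Γ = Γ * cfcₙ k Γ * Γ := by
    rw [cfcₙ_mul (fun t => t * k t) (fun t => t) Γ c1.continuousOn (by simp) continuousOn_id rfl,
      h1, hid]
  have c2 : Continuous fun t => t * k t * t := by fun_prop
  rw [hk', cfcₙ_sub (fun t => t) (fun t => t * k t * t) Γ continuousOn_id rfl c2.continuousOn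
    (by simp), h2, hid, h0]

end FunctionalCalculus

section HilbertModule

variable {A : Type*} [NonUnitalCStarAlgebra A] [PartialOrder A]
  {E : Type*} [NormedAddCommGroup E] [NormedSpace ℂ E] [CompleteSpace E]

/-- The inner product as a linear map in its second variable. -/
def ipRight (A : Type*) [NonUnitalCStarAlgebra A] [PartialOrder A]
    {E : Type*} [NormedAddCommGroup E] [NormedSpace ℂ E] [CompleteSpace E]
    [RightHilbertModule A E] (x : E) : E →ₗ[ℂ] A where
  toFun y := ip x y
  map_add' := ip_add_right x
  map_smul' c y := ip_smul_right c x y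

section Algebra

variable [RightHilbertModule A E]

theorem ip_sub_right (x y z : E) : (ip x (y - z) : A) = ip x y - ip x z :=
  map_sub (ipRight A x) y z

theorem ip_zero_right (x : E) : (ip x 0 : A) = 0 := map_zero (ipRight A x)

theorem ip_sum_right {ι : Type*} (s : Finset ι) (x : E) (f : ι → E) :
    (ip x (∑ i ∈ s, f i) : A) = ∑ i ∈ s, ip x (f i) := map_sum (ipRight A x) f s

theorem ip_add_left (x y z : E) : (ip (x + y) z : A) = ip x z + ip y z := by
  rw [← star_ip, ip_add_right, star_add, star_ip, star_ip]

theorem ip_sub_left (x y z : E) : (ip (x - y) z : A) = ip x z - ip y z := by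
  rw [← star_ip, ip_sub_right, star_sub, star_ip, star_ip]

theorem ip_zero_left (x : E) : (ip 0 x : A) = 0 := by
  rw [← star_ip, ip_zero_right, star_zero]

theorem ip_smul_left (c : ℂ) (x y : E) : (ip (c • x) y : A) = star c • ip x y := by
  rw [← star_ip, ip_smul_right, star_smul, star_ip]

theorem ip_sum_left {ι : Type*} (s : Finset ι) (f : ι → E) (x : E) :
    (ip (∑ i ∈ s, f i) x : A) = ∑ i ∈ s, ip (f i) x := by
  rw [← star_ip, ip_sum_right, star_sum]; simp only [star_ip]

theorem ip_ract_left (x y : E) (a : A) : (ip (ract x a) y : A) = star a * ip x y := by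
  rw [← star_ip, ip_ract_right, star_mul, star_ip]

/-- The form `⟨x, (1 - ∑_{ξ ∈ H} θ_{ξ,ξ}) y⟩`. -/
def defect (H : Finset E) (x y : E) : A := ip x y - ∑ ξ ∈ H, ip x ξ * ip ξ y

theorem opLE_id_iff (H : Finset E) :
    OpLE A (fun η => ∑ ξ ∈ H, theta A ξ ξ η) (fun η : E => η) ↔
      ∀ x : E, (∑ ξ ∈ H, ip x ξ * ip ξ x : A) ≤ ip x x := by
  simp only [OpLE, theta, ip_sum_right, ip_ract_right]

theorem phaseInvariant_ip_mul_ip (x y : E) :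
    PhaseInvariant fun ξ : E => (ip x ξ * ip ξ y : A) := by
  refine ⟨by simp [ip_zero_right], fun c hc ξ => ?_⟩
  simp only [ip_smul_left, ip_smul_right, smul_mul_assoc, mul_smul_comm, smul_smul]
  rw [mul_comm, mul_star_self_of_norm_eq_one hc, one_smul]

theorem phaseInvariant_ip_apply (T : E →ₗ[ℂ] E) :
    PhaseInvariant fun ξ : E => (ip ξ (T ξ) : A) := by
  refine ⟨by simp [ip_zero_left], fun c hc ξ => ?_⟩
  simp only [map_smul, ip_smul_left, ip_smul_right, smul_smul]
  rw [mul_star_self_of_norm_eq_one hc, one_smul]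

end Algebra

variable [StarOrderedRing A]

/-- The functional calculus behind the construction of approximate units. -/
theorem exists_approx_inverse {Γ : A} (hΓ : 0 ≤ Γ) {ε : ℝ} (hε : 0 < ε) :
    ∃ h g : A, star h = h ∧ star g = g ∧ g * g = h + h - h * Γ * h ∧
      ‖Γ - Γ * (h + h - h * Γ * h) * Γ‖ ≤ ε := by
  have hsa : IsSelfAdjoint Γ := .of_nonneg hΓ
  have hpos : ∀ t : ℝ, 0 < t ^ 2 + ε ^ 2 := fun t => by positivity
  obtain ⟨f, hf⟩ : ∃ f : ℝ → ℝ, f = fun t => t / (t ^ 2 + ε ^ 2) := ⟨_, rfl⟩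
  have hft : ∀ t, f t = t / (t ^ 2 + ε ^ 2) := fun t => by rw [hf]
  have hfc : Continuous f := by
    rw [hf]; exact Continuous.div (by fun_prop) (by fun_prop) fun t => (hpos t).ne'
  have hf0 : f 0 = 0 := by simp [hf]
  have hspec : ∀ t ∈ quasispectrum ℝ Γ, 0 ≤ t := fun t ht =>
    quasispectrum_nonneg_of_nonneg Γ hΓ t ht
  obtain ⟨k, hk⟩ : ∃ k : ℝ → ℝ, k = fun t => √(f t + f t - f t * t * f t) := ⟨_, rfl⟩
  have hkc : Continuous k := by rw [hk]; fun_prop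
  have hk0 : k 0 = 0 := by simp [hk, hf0]
  refine ⟨cfcₙ f Γ, cfcₙ k Γ, (cfcₙ_predicate f Γ : IsSelfAdjoint _),
    (cfcₙ_predicate k Γ : IsSelfAdjoint _), ?_, ?_⟩
  · rw [← cfcₙ_two_mul_sub hsa hfc hf0,
      ← cfcₙ_mul k k Γ hkc.continuousOn hk0 hkc.continuousOn hk0]
    refine cfcₙ_congr fun t ht => ?_
    have h0 := hspec t ht
    have : f t + f t - f t * t * f t = t * (t ^ 2 + 2 * ε ^ 2) / (t ^ 2 + ε ^ 2) ^ 2 := by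
      have := (hpos t).ne'
      rw [hft]; field_simp; ring
    have hnn : 0 ≤ f t + f t - f t * t * f t := by rw [this]; positivity
    simp only [hk]
    exact Real.mul_self_sqrt hnn
  · rw [← cfcₙ_mul_one_sub_sq hsa hfc hf0]
    refine norm_cfcₙ_le fun t ht => ?_
    have h0 := hspec t ht
    have : t - t * (f t + f t - f t * t * f t) * t = t * ε ^ 4 / (t ^ 2 + ε ^ 2) ^ 2 := by
      have := (hpos t).ne'
      rw [hft]; field_simp; ring
    rw [this, Real.norm_of_nonneg (by positivity), div_le_iff₀ (by positivity)]
    have h2 : t * ε ≤ t ^ 2 + ε ^ 2 := by nlinarith [sq_nonneg (t - ε), sq_nonneg t, sq_nonneg ε]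
    have h3 : ε ^ 2 ≤ t ^ 2 + ε ^ 2 := by nlinarith [sq_nonneg t]
    have h4 : (t * ε) * ε ^ 2 ≤ (t ^ 2 + ε ^ 2) * (t ^ 2 + ε ^ 2) :=
      mul_le_mul h2 h3 (by positivity) (by positivity)
    have h5 := mul_le_mul_of_nonneg_left h4 hε.le
    linarith

/-- Every positive contraction `d` equals `2 e - e²` for a selfadjoint `e`. -/
theorem exists_add_sub_mul_eq {d : A} (hd : 0 ≤ d) (hd1 : ‖d‖ ≤ 1) :
    ∃ e : A, star e = e ∧ e + e - e * e = d := by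
  have hsa : IsSelfAdjoint d := .of_nonneg hd
  set f : ℝ → ℝ := fun t => 1 - √(1 - t) with hf
  have hfc : Continuous f := by fun_prop
  have hf0 : f 0 = 0 := by simp [hf]
  refine ⟨cfcₙ f d, (cfcₙ_predicate f d : IsSelfAdjoint _), ?_⟩
  have h1 : cfcₙ (fun t => f t + f t - f t * f t) d =
      cfcₙ f d + cfcₙ f d - cfcₙ f d * cfcₙ f d := by
    rw [cfcₙ_sub _ _ d, cfcₙ_add _ _ d, cfcₙ_mul _ _ d]
  rw [← h1]
  conv_rhs => rw [← cfcₙ_id' ℝ d]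
  refine cfcₙ_congr fun t ht => ?_
  have ht1 : t ≤ 1 := by
    have := NonUnitalIsometricContinuousFunctionalCalculus.norm_quasispectrum_le d ht
    exact (le_abs_self t).trans (this.trans hd1)
  have := Real.mul_self_sqrt (sub_nonneg.2 ht1)
  simp only [hf]
  nlinarith

section Norm

variable [RightHilbertModule A E]

theorem ip_mul_ip_le {x : E} (hx : ‖x‖ ≤ 1) (y : E) : (ip y x * ip x y : A) ≤ ip y y := by
  have h0 : (0 : A) ≤ ip (y - ract x (ip x y : A)) (y - ract x (ip x y : A)) := ip_self_nonneg _
  have hexp : (ip (y - ract x (ip x y : A)) (y - ract x (ip x y : A)) : A) =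
      ip y y - ip y x * ip x y - ip y x * ip x y + ip y x * ip x x * ip x y := by
    simp only [ip_sub_left, ip_sub_right, ip_ract_left, ip_ract_right, star_ip, mul_assoc,
      sub_mul]
    abel
  have hn : ‖(ip x x : A)‖ ≤ 1 := by
    rw [← norm_sq_eq]; exact pow_le_one₀ (norm_nonneg _) hx
  have h1 : (ip y x * ip x x * ip x y : A) ≤ ip y x * ip x y := by
    have h := CStarAlgebra.star_left_conjugate_le_norm_smul (a := (ip x y : A)) (b := (ip x x : A))
      (.of_nonneg (ip_self_nonneg x))
    rw [star_ip] at h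
    refine h.trans ?_
    have h2 : (0 : A) ≤ ip y x * ip x y := by
      rw [← star_ip x y]; exact star_mul_self_nonneg _
    calc ‖(ip x x : A)‖ • (ip y x * ip x y : A) ≤ (1 : ℝ) • (ip y x * ip x y : A) :=
          smul_le_smul_of_nonneg_right hn h2
      _ = _ := one_smul _ _
  rw [hexp] at h0
  have h2 : (0 : A) ≤ ip y y - ip y x * ip x y := by
    refine h0.trans ?_
    calc _ ≤ (ip y y - ip y x * ip x y - ip y x * ip x y + ip y x * ip x y : A) := by gcongr
      _ = _ := by abel
  exact sub_nonneg.1 h2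

theorem norm_ip_le (x y : E) : ‖(ip x y : A)‖ ≤ ‖x‖ * ‖y‖ := by
  have key : ∀ x : E, ‖x‖ ≤ 1 → ‖(ip x y : A)‖ ≤ ‖y‖ := fun x hx => by
    have h := CStarAlgebra.norm_le_norm_of_nonneg_of_le (a := (ip y x * ip x y : A))
      (by rw [← star_ip x y]; exact star_mul_self_nonneg _) (ip_mul_ip_le hx y)
    rw [← star_ip x y, CStarRing.norm_star_mul_self, ← norm_sq_eq] at h
    exact abs_le_of_sq_le_sq' (by nlinarith) (norm_nonneg _) |>.2
  rcases eq_or_ne x 0 with rfl | hx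
  · simp [ip_zero_left]
  · have hx' : ‖x‖ ≠ 0 := norm_ne_zero_iff.2 hx
    have h := key (((‖x‖⁻¹ : ℝ) : ℂ) • x) (by
      rw [norm_smul]; simp [hx'])
    rw [ip_smul_left, norm_smul] at h
    simp only [norm_star, Complex.norm_real, norm_inv, norm_norm] at h
    rwa [inv_mul_le_iff₀ (by positivity)] at h

theorem continuous_ip : Continuous fun z : E × E => (ip z.1 z.2 : A) := by
  let L : E →L[ℝ] E →L[ℝ] A := LinearMap.mkContinuous₂
    (LinearMap.mk₂ ℝ (fun x y : E => (ip x y : A)) ip_add_left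
      (fun c x y => by
        have := ip_smul_left (A := A) (c : ℂ) x y
        simpa using this) ip_add_right
      (fun c x y => by
        have := ip_smul_right (A := A) (c : ℂ) x y
        simpa using this)) 1 (fun x y => by simpa using norm_ip_le x y)
  exact L.continuous₂

end Norm

end HilbertModule

section Frames

variable {A : Type*} [NonUnitalCStarAlgebra A] [PartialOrder A]
  {E : Type*} [NormedAddCommGroup E] [NormedSpace ℂ E] [CompleteSpace E]

/-- The finite set `H` satisfies `∑_{ξ ∈ H} θ_{ξ,ξ} ≤ 1`. -/
def IsSubframe (A : Type*) [NonUnitalCStarAlgebra A] [PartialOrder A]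
    {E : Type*} [NormedAddCommGroup E] [NormedSpace ℂ E] [CompleteSpace E]
    [RightHilbertModule A E] (H : Finset E) : Prop :=
  OpLE A (fun η => ∑ ξ ∈ H, theta A ξ ξ η) (fun η : E => η)

/-- The operator `1 - ∑_{ξ ∈ H} θ_{ξ,ξ}` has the form `S* S`. -/
def IsSplitSubframe (A : Type*) [NonUnitalCStarAlgebra A] [PartialOrder A]
    {E : Type*} [NormedAddCommGroup E] [NormedSpace ℂ E] [CompleteSpace E]
    [RightHilbertModule A E] (H : Finset E) : Prop :=
  ∃ S : E →ₗ[ℂ] E, ∀ x y, (defect H x y : A) = ip (S x) (S y)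

variable [RightHilbertModule A E]

/-- The form `⟨x, (1 - ∑_{i ∈ s} θ_{v i, v i}) x⟩` of a finite family of vectors. -/
def familyDefect {ι : Type*} (s : Finset ι) (v : ι → E) (x : E) : A :=
  ip x x - ∑ i ∈ s, ip x (v i) * ip (v i) x

theorem isSubframe_iff_sum_le (H : Finset E) :
    IsSubframe A H ↔ ∀ x : E, (∑ ξ ∈ H, ip x ξ * ip ξ x : A) ≤ ip x x := opLE_id_iff H

theorem sum_add_defect (H : Finset E) (x y : E) :
    (∑ ξ ∈ H, ip x ξ * ip ξ y + defect H x y : A) = ip x y := by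
  simp [defect]

theorem ip_mul_ip_nonneg [StarOrderedRing A] (x y : E) : (0 : A) ≤ ip x y * ip y x := by
  rw [← star_ip y x]; exact star_mul_self_nonneg _

variable (A E) in
/-- The filter of the finite sets `H` such that `∑_{ξ ∈ H} θ_{ξ,ξ}` approximates the identity. -/
def frameFilter : Filter (Finset E) :=
  𝓟 {H | IsSplitSubframe A H} ⊓
    comap (fun (H : Finset E) (η : E) => (defect H η η : A)) (𝓝 0)

theorem eventually_isSplitSubframe : ∀ᶠ H in frameFilter A E, IsSplitSubframe A H :=
  mem_inf_of_left (mem_principal_self _)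

theorem tendsto_defect (η : E) :
    Tendsto (fun H : Finset E => (defect H η η : A)) (frameFilter A E) (𝓝 0) :=
  (tendsto_pi_nhds.1 (tendsto_comap.mono_left inf_le_right :
    Tendsto (fun (H : Finset E) (η : E) => (defect H η η : A)) (frameFilter A E) (𝓝 0))) η

variable [StarOrderedRing A]

theorem IsSubframe.defect_nonneg {H : Finset E} (hH : IsSubframe A H) (x : E) :
    (0 : A) ≤ defect H x x := sub_nonneg.2 ((isSubframe_iff_sum_le H).1 hH x)

theorem IsSplitSubframe.isSubframe {H : Finset E} (hH : IsSplitSubframe A H) :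
    IsSubframe A H := by
  obtain ⟨S, hS⟩ := hH
  refine (isSubframe_iff_sum_le H).2 fun x => sub_nonneg.1 ?_
  have h := hS x x
  rw [defect] at h
  rw [h]
  exact ip_self_nonneg _

/-- One step of the construction of an approximate unit. -/
theorem IsSplitSubframe.exists_norm_defect_le {H : Finset E} (hH : IsSplitSubframe A H) (η : E)
    {ε : ℝ} (hε : 0 < ε) :
    ∃ H' : Finset E, IsSplitSubframe A H' ∧ ‖(defect H' η η : A)‖ ≤ ε ∧
      ∀ x, (defect H' x x : A) ≤ defect H x x := by
  obtain ⟨S, hS⟩ := hH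
  obtain ⟨h, g, hh, hg, hgg, hnorm⟩ :=
    exists_approx_inverse (ip_self_nonneg (A := A) (S η)) hε
  set ζ : E := ract (η - ∑ ξ ∈ H, ract ξ (ip ξ η : A)) g with hζ
  have hxζ : ∀ x, (ip x ζ : A) = ip (S x) (S η) * g := fun x => by
    rw [hζ, ip_ract_right, ip_sub_right, ip_sum_right, ← hS, defect]
    simp only [ip_ract_right]
  have hζy : ∀ y, (ip ζ y : A) = g * ip (S η) (S y) := fun y => by
    rw [← star_ip, hxζ, star_mul, hg, star_ip]
  obtain ⟨H', hH'⟩ := exists_sum_eq_add_sum A H ζ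
  have hdef : ∀ x y, (defect H' x y : A) = defect H x y - ip x ζ * ip ζ y := fun x y => by
    rw [defect, hH' _ (phaseInvariant_ip_mul_ip x y), defect]
    abel
  have hζζ : ∀ x y, (ip x ζ * ip ζ y : A) = ip (S x) (S η) *
      (h + h - h * ip (S η) (S η) * h) * ip (S η) (S y) := fun x y => by
    rw [hxζ, hζy, ← hgg]; simp only [mul_assoc]
  refine ⟨H', ⟨S - (ract (S η)) ∘ₗ (LinearMap.mulLeft ℂ h) ∘ₗ (ipRight A (S η)) ∘ₗ S,
    fun x y => ?_⟩, ?_, fun x => ?_⟩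
  · have happ : ∀ z, (S - (ract (S η)) ∘ₗ (LinearMap.mulLeft ℂ h) ∘ₗ (ipRight A (S η)) ∘ₗ S) z =
        S z - ract (S η) (h * (ip (S η) (S z) : A)) := fun z => rfl
    rw [hdef, hζζ, hS, happ, happ]
    simp only [ip_sub_left, ip_sub_right, ip_ract_left, ip_ract_right, star_mul, star_ip, hh,
      mul_add, add_mul, mul_sub, sub_mul, mul_assoc]
    abel
  · rw [hdef, hζζ, hS]
    exact hnorm
  · rw [hdef]
    exact sub_le_self _ (ip_mul_ip_nonneg x ζ)

variable (A) in
theorem exists_isSplitSubframe (F : Finset E) {ε : ℝ} (hε : 0 < ε) :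
    ∃ H : Finset E, IsSplitSubframe A H ∧ ∀ η ∈ F, ‖(defect H η η : A)‖ ≤ ε := by
  classical
  induction F using Finset.induction_on with
  | empty => exact ⟨∅, ⟨LinearMap.id, fun x y => by simp [defect]⟩, by simp⟩
  | insert η F _ ih =>
    obtain ⟨H, hH, hF⟩ := ih
    obtain ⟨H', hH', hη, hle⟩ := hH.exists_norm_defect_le η hε
    refine ⟨H', hH', fun x hx => ?_⟩
    rcases Finset.mem_insert.1 hx with rfl | hx
    · exact hη
    · exact (CStarAlgebra.norm_le_norm_of_nonneg_of_le
        (hH'.isSubframe.defect_nonneg x) (hle x)).trans (hF x hx)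

instance frameFilter_neBot : (frameFilter A E).NeBot := by
  rw [frameFilter, inf_comm, inf_principal_neBot_iff]
  rintro U ⟨V, hV, hVU⟩
  rw [nhds_pi, mem_pi] at hV
  obtain ⟨I, hI, t, ht, htV⟩ := hV
  obtain ⟨ε, hε, hball⟩ : ∃ ε > 0, ∀ η ∈ I, Metric.closedBall (0 : A) ε ⊆ t η := by
    have h : ∀ η ∈ I, ∀ᶠ ε in 𝓝[>] (0 : ℝ), Metric.closedBall (0 : A) ε ⊆ t η := fun η _ => by
      obtain ⟨δ, hδ, hδt⟩ := Metric.nhds_basis_closedBall.mem_iff.1 (ht η)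
      filter_upwards [Ioc_mem_nhdsGT hδ] with ε hε
      exact (Metric.closedBall_subset_closedBall hε.2).trans hδt
    obtain ⟨ε, h1, h2⟩ :=
      (((eventually_all_finite hI).2 h).and self_mem_nhdsWithin).exists
    exact ⟨ε, h2, h1⟩
  obtain ⟨H, hH, hF⟩ := exists_isSplitSubframe A hI.toFinset hε
  refine ⟨H, hVU (htV fun η hη => hball η hη ?_), hH⟩
  simpa using hF η (hI.mem_toFinset.2 hη)

end Frames

section Weights

variable {A : Type*} [NonUnitalCStarAlgebra A] [PartialOrder A]

/-- A bounded trace, considered on the positive cone only. -/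
structure IsTraceWeight (σ : A → ℝ) : Prop where
  nonneg : ∀ a, 0 ≤ a → 0 ≤ σ a
  add : ∀ a b, 0 ≤ a → 0 ≤ b → σ (a + b) = σ a + σ b
  bound : ∃ C : ℝ, ∀ a, 0 ≤ a → σ a ≤ C * ‖a‖
  trace : ∀ c, σ (star c * c) = σ (c * star c)

theorem IsTracialState.isTraceWeight {τ : A →L[ℂ] ℂ} (hτ : IsTracialState τ) :
    IsTraceWeight fun a => (τ a).re where
  nonneg a ha := (Complex.le_def.1 (hτ.nonneg a ha)).1
  add a b _ _ := by simp
  bound := ⟨1, fun a _ => by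
    refine (Complex.re_le_norm _).trans ((τ.le_opNorm a).trans ?_)
    rw [hτ.norm_eq_one]⟩
  trace c := by rw [hτ.tracial]

namespace IsTraceWeight

variable {σ : A → ℝ}

theorem zero (hσ : IsTraceWeight σ) : σ 0 = 0 := by
  have := hσ.add 0 0 le_rfl le_rfl
  simpa using this

theorem tendsto_zero (hσ : IsTraceWeight σ) {ι : Type*} {l : Filter ι} {f : ι → A}
    (hf : ∀ᶠ i in l, 0 ≤ f i) (h : Tendsto f l (𝓝 0)) : Tendsto (fun i => σ (f i)) l (𝓝 0) := by
  obtain ⟨C, hC⟩ := hσ.bound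
  have h1 : Tendsto (fun i => C * ‖f i‖) l (𝓝 0) := by
    simpa using (h.norm.const_mul C)
  exact tendsto_of_tendsto_of_tendsto_of_le_of_le' tendsto_const_nhds h1
    (hf.mono fun i hi => hσ.nonneg _ hi) (hf.mono fun i hi => hC _ hi)

variable [StarOrderedRing A]

theorem sum (hσ : IsTraceWeight σ) {ι : Type*} (s : Finset ι) (f : ι → A)
    (hf : ∀ i ∈ s, 0 ≤ f i) :
    σ (∑ i ∈ s, f i) = ∑ i ∈ s, σ (f i) := by
  classical
  induction s using Finset.induction_on with
  | empty => simp [hσ.zero]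
  | insert i s hi ih =>
    have hs : ∀ j ∈ s, 0 ≤ f j := fun j hj => hf j (Finset.mem_insert_of_mem hj)
    rw [Finset.sum_insert hi, Finset.sum_insert hi,
      hσ.add _ _ (hf i (Finset.mem_insert_self i s)) (Finset.sum_nonneg hs), ih hs]

theorem mono (hσ : IsTraceWeight σ) {a b : A} (ha : 0 ≤ a) (hab : a ≤ b) : σ a ≤ σ b := by
  have h := hσ.add a (b - a) ha (sub_nonneg.2 hab)
  rw [add_sub_cancel] at h
  linarith [hσ.nonneg _ (sub_nonneg.2 hab)]

end IsTraceWeight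

variable {E : Type*} [NormedAddCommGroup E] [NormedSpace ℂ E] [CompleteSpace E]
  [CStarCorrespondence A E]

theorem ip_lact_star_mul_self (c : A) (x : E) :
    (ip x (lact (star c * c) x) : A) = ip (lact c x) (lact c x) := by
  rw [ip_lact_left, lact_mul]

variable (E) in
/-- The induced trace, for functions on `A`. -/
noncomputable def weightTrace (σ : A → ℝ) (a : A) : ENNReal :=
  ⨆ H : {H : Finset E // IsSubframe A H}, ENNReal.ofReal (∑ ξ ∈ H.1, σ (ip ξ (lact a ξ)))

variable {σ : A → ℝ}

theorem sum_le_toReal_weightTrace {a : A} (h : weightTrace E σ a ≠ ⊤) {H : Finset E}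
    (hH : IsSubframe A H) :
    ∑ ξ ∈ H, σ (ip ξ (lact a ξ)) ≤ (weightTrace E σ a).toReal := by
  have h1 : ENNReal.ofReal (∑ ξ ∈ H, σ (ip ξ (lact a ξ))) ≤ weightTrace E σ a :=
    le_iSup (fun H : {H : Finset E // IsSubframe A H} =>
      ENNReal.ofReal (∑ ξ ∈ H.1, σ (ip ξ (lact a ξ)))) ⟨H, hH⟩
  exact (ENNReal.ofReal_le_iff_le_toReal h).1 h1

theorem weightTrace_le {a : A} {C : ℝ}
    (h : ∀ H : Finset E, IsSubframe A H → ∑ ξ ∈ H, σ (ip ξ (lact a ξ)) ≤ C) :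
    weightTrace E σ a ≤ ENNReal.ofReal C :=
  iSup_le fun H => ENNReal.ofReal_le_ofReal (h H.1 H.2)

theorem toReal_weightTrace_le {a : A} {C : ℝ} (hC : 0 ≤ C)
    (h : ∀ H : Finset E, IsSubframe A H → ∑ ξ ∈ H, σ (ip ξ (lact a ξ)) ≤ C) :
    (weightTrace E σ a).toReal ≤ C :=
  ENNReal.toReal_le_of_le_ofReal hC (weightTrace_le h)

variable [StarOrderedRing A]

theorem exists_star_mul_self_eq {a : A} (ha : 0 ≤ a) :
    ∃ b : A, star b = b ∧ star b * b = a ∧ b * star b = a := by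
  have hb : star (CFC.sqrt a) = CFC.sqrt a :=
    (IsSelfAdjoint.of_nonneg (CFC.sqrt_nonneg a) : IsSelfAdjoint _)
  exact ⟨CFC.sqrt a, hb, by rw [hb]; exact CFC.sqrt_mul_sqrt_self a ha,
    by rw [hb]; exact CFC.sqrt_mul_sqrt_self a ha⟩

theorem ip_lact_nonneg {a : A} (ha : 0 ≤ a) (x : E) : (0 : A) ≤ ip x (lact a x) := by
  obtain ⟨b, -, hb, -⟩ := exists_star_mul_self_eq ha
  rw [← hb, ip_lact_star_mul_self]
  exact ip_self_nonneg _

theorem IsTraceWeight.sum_conj_le (hσ : IsTraceWeight σ) {ι : Type*} (s : Finset ι) (v : ι → E)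
    {H' : Finset E} (hv : ∀ x : E, (0 : A) ≤ familyDefect s v x)
    (hH' : IsSubframe A H') (c : A) :
    ∑ ξ ∈ H', σ (ip ξ (lact (star c * c) ξ)) ≤ ∑ i ∈ s, σ (ip (v i) (lact (c * star c) (v i))) +
      ∑ ξ ∈ H', σ (familyDefect s v (lact c ξ)) := by
  have h1 : ∀ ξ ∈ H', σ (ip ξ (lact (star c * c) ξ)) =
      ∑ i ∈ s, σ (ip (v i) (lact c ξ) * ip (lact c ξ) (v i)) +
        σ (familyDefect s v (lact c ξ)) := by
    intro ξ _
    have h0 : σ (ip ξ (lact (star c * c) ξ)) = σ (∑ i ∈ s, ip (lact c ξ) (v i) * ip (v i) (lact c ξ)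
        + familyDefect s v (lact c ξ)) := by
      rw [familyDefect, ip_lact_star_mul_self, add_sub_cancel]
    rw [h0, hσ.add _ _ (Finset.sum_nonneg fun i _ => ip_mul_ip_nonneg _ _) (hv _),
      hσ.sum _ _ (fun i _ => ip_mul_ip_nonneg _ _)]
    congr 1
    refine Finset.sum_congr rfl fun i _ => ?_
    have := hσ.trace (ip (v i) (lact c ξ))
    rwa [star_ip] at this
  rw [Finset.sum_congr rfl h1, Finset.sum_add_distrib, Finset.sum_comm]
  gcongr with i hi
  rw [← hσ.sum _ _ (fun ξ _ => ip_mul_ip_nonneg _ _)]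
  refine hσ.mono (Finset.sum_nonneg fun ξ _ => ip_mul_ip_nonneg _ _) ?_
  have h2 := (isSubframe_iff_sum_le H').1 hH' (lact (star c) (v i))
  have h3 : (ip (v i) (lact (c * star c) (v i)) : A) =
      ip (lact (star c) (v i)) (lact (star c) (v i)) := by
    rw [← ip_lact_star_mul_self, star_star]
  rw [h3]
  refine le_trans (le_of_eq (Finset.sum_congr rfl fun ξ _ => ?_)) h2
  rw [ip_lact_left (star c), star_star, ← star_ip (lact (star c) (v i)) ξ, ip_lact_left (star c),
    star_star, star_ip]

theorem IsTraceWeight.tendsto_sum_defect (hσ : IsTraceWeight σ) (F : Finset E) (v : E → E) :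
    Tendsto (fun H : Finset E => ∑ ξ ∈ F, σ (defect H (v ξ) (v ξ))) (frameFilter A E) (𝓝 0) := by
  rw [← Finset.sum_const_zero (s := F)]
  refine tendsto_finsetSum F fun ξ _ => hσ.tendsto_zero ?_ (tendsto_defect (v ξ))
  exact eventually_isSplitSubframe.mono fun H hH => hH.isSubframe.defect_nonneg _

theorem IsTraceWeight.sum_le_sum_add_defect (hσ : IsTraceWeight σ) {H H' : Finset E}
    (hH : IsSubframe A H) (hH' : IsSubframe A H') (c : A) :
    ∑ ξ ∈ H', σ (ip ξ (lact (star c * c) ξ)) ≤ ∑ ξ ∈ H, σ (ip ξ (lact (c * star c) ξ)) +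
      ∑ ξ ∈ H', σ (defect H (lact c ξ) (lact c ξ)) :=
  hσ.sum_conj_le H id (fun x => hH.defect_nonneg x) hH' c

theorem IsTraceWeight.sum_nonneg (hσ : IsTraceWeight σ) {a : A} (ha : 0 ≤ a) (H : Finset E) :
    0 ≤ ∑ ξ ∈ H, σ (ip ξ (lact a ξ)) :=
  Finset.sum_nonneg fun ξ _ => hσ.nonneg _ (ip_lact_nonneg ha ξ)

/-- The supremum in the definition of the induced trace is a limit along the frame filter. -/
theorem IsTraceWeight.tendsto_weightTrace (hσ : IsTraceWeight σ) {a : A} (ha : 0 ≤ a)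
    (hfin : weightTrace E σ a ≠ ⊤) :
    Tendsto (fun H : Finset E => ∑ ξ ∈ H, σ (ip ξ (lact a ξ))) (frameFilter A E)
      (𝓝 (weightTrace E σ a).toReal) := by
  obtain ⟨b, -, hb, hb'⟩ := exists_star_mul_self_eq ha
  refine tendsto_order.2 ⟨fun r hr => ?_, fun r hr => ?_⟩
  · obtain ⟨H', hH', hr'⟩ : ∃ H' : Finset E, IsSubframe A H' ∧
        r < ∑ ξ ∈ H', σ (ip ξ (lact a ξ)) := by
      by_contra! hcon
      by_cases h0 : 0 ≤ r
      · exact absurd (toReal_weightTrace_le h0 hcon) (not_le.2 hr)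
      · have := hcon ∅ ((isSubframe_iff_sum_le ∅).2 fun x => by simpa using ip_self_nonneg x)
        simp only [Finset.sum_empty] at this
        exact h0 this
    have hd := hσ.tendsto_sum_defect H' (fun ξ => lact b ξ)
    have hev := (tendsto_order.1 hd).2 _ (sub_pos.2 hr')
    filter_upwards [hev, eventually_isSplitSubframe] with H h1 h2
    have h3 := hσ.sum_le_sum_add_defect h2.isSubframe hH' b
    rw [hb, hb'] at h3
    linarith
  · filter_upwards [eventually_isSplitSubframe] with H h2
    exact (sum_le_toReal_weightTrace hfin h2.isSubframe).trans_lt hr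

theorem IsTraceWeight.toReal_weightTrace_conj_le (hσ : IsTraceWeight σ) (c : A)
    (hfin : weightTrace E σ (c * star c) ≠ ⊤) :
    (weightTrace E σ (star c * c)).toReal ≤ (weightTrace E σ (c * star c)).toReal := by
  refine toReal_weightTrace_le ENNReal.toReal_nonneg fun H' hH' => ?_
  have hd := (hσ.tendsto_sum_defect H' (fun ξ => lact c ξ)).const_add
    (weightTrace E σ (c * star c)).toReal
  rw [add_zero] at hd
  refine ge_of_tendsto hd ?_
  filter_upwards [eventually_isSplitSubframe] with H hH
  exact (hσ.sum_le_sum_add_defect hH.isSubframe hH' c).trans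
    (by gcongr; exact sum_le_toReal_weightTrace hfin hH.isSubframe)

/-- A bounded induced trace is a trace. -/
theorem IsTraceWeight.weightTrace (hσ : IsTraceWeight σ)
    (hfin : ∀ a : A, 0 ≤ a → weightTrace E σ a ≠ ⊤)
    (hbound : ∃ C : ℝ, ∀ a : A, 0 ≤ a → (weightTrace E σ a).toReal ≤ C * ‖a‖) :
    IsTraceWeight fun a => (weightTrace E σ a).toReal where
  nonneg _ _ := ENNReal.toReal_nonneg
  add a b ha hb := by
    have h1 := (hσ.tendsto_weightTrace ha (hfin a ha)).add
      (hσ.tendsto_weightTrace hb (hfin b hb))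
    refine tendsto_nhds_unique (hσ.tendsto_weightTrace (add_nonneg ha hb)
      (hfin _ (add_nonneg ha hb))) (h1.congr fun H => ?_)
    rw [← Finset.sum_add_distrib]
    refine Finset.sum_congr rfl fun ξ _ => ?_
    rw [← hσ.add _ _ (ip_lact_nonneg ha ξ) (ip_lact_nonneg hb ξ), map_add, LinearMap.add_apply,
      ip_add_right]
  bound := hbound
  trace c := by
    refine le_antisymm (hσ.toReal_weightTrace_conj_le c (hfin _ (mul_star_self_nonneg c))) ?_
    have h := hσ.toReal_weightTrace_conj_le (E := E) (star c)
      (by rw [star_star]; exact hfin _ (star_mul_self_nonneg c))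
    rwa [star_star] at h

end Weights

theorem exists_eq_sum_of_mem_span {E F Z : Type*} [AddCommGroup E] [Module ℂ E]
    [AddCommGroup F] [Module ℂ F] [AddCommGroup Z] [Module ℂ Z] {m : E →ₗ[ℂ] F →ₗ[ℂ] Z} {y : Z}
    (hy : y ∈ Submodule.span ℂ {y : Z | ∃ (ξ : E) (ζ : F), y = m ξ ζ}) :
    ∃ (n : ℕ) (ξ : Fin n → E) (ζ : Fin n → F), y = ∑ j, m (ξ j) (ζ j) := by
  obtain ⟨n, f, g, rfl⟩ := Submodule.mem_span_set'.1 hy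
  choose ξ ζ h using fun j => (g j).2
  refine ⟨n, fun j => f j • ξ j, ζ, Finset.sum_congr rfl fun j _ => ?_⟩
  rw [h j, map_smul, LinearMap.smul_apply]

section Tensor

variable {A : Type*} [NonUnitalCStarAlgebra A] [PartialOrder A]
  {E F Z : Type*} [NormedAddCommGroup E] [NormedSpace ℂ E] [CompleteSpace E]
  [NormedAddCommGroup F] [NormedSpace ℂ F] [CompleteSpace F]
  [NormedAddCommGroup Z] [NormedSpace ℂ Z] [CompleteSpace Z]

section Family

variable [RightHilbertModule A Z] {ι : Type*} (s : Finset ι) (v : ι → Z)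

theorem familyDefect_add_add_familyDefect_sub (x y : Z) :
    (familyDefect s v (x + y) + familyDefect s v (x - y) : A) =
      (familyDefect s v x + familyDefect s v x) + (familyDefect s v y + familyDefect s v y) := by
  have h : ∀ i, (ip (x + y) (v i) * ip (v i) (x + y) + ip (x - y) (v i) * ip (v i) (x - y) : A) =
      (ip x (v i) * ip (v i) x + ip x (v i) * ip (v i) x) +
        (ip y (v i) * ip (v i) y + ip y (v i) * ip (v i) y) := fun i => by
    simp only [ip_add_left, ip_add_right, ip_sub_left, ip_sub_right, add_mul, mul_add, sub_mul,
      mul_sub]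
    abel
  have h' := Finset.sum_congr (rfl : s = s) fun i _ => h i
  simp only [Finset.sum_add_distrib] at h'
  have h'' : (ip (x + y) (x + y) + ip (x - y) (x - y) : A) =
      (ip x x + ip x x) + (ip y y + ip y y) := by
    simp only [ip_add_left, ip_add_right, ip_sub_left, ip_sub_right]
    abel
  simp only [familyDefect]
  rw [sub_add_sub_comm, h', h'']
  abel

variable [StarOrderedRing A]

theorem familyDefect_le_ip (x : Z) : (familyDefect s v x : A) ≤ ip x x :=
  sub_le_self _ (Finset.sum_nonneg fun _ _ => ip_mul_ip_nonneg _ _)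

theorem continuous_familyDefect : Continuous fun x : Z => (familyDefect s v x : A) := by
  have h1 : ∀ i, Continuous fun x : Z => (ip x (v i) : A) := fun i =>
    continuous_ip.comp (continuous_id.prodMk continuous_const)
  have h2 : ∀ i, Continuous fun x : Z => (ip (v i) x : A) := fun i =>
    continuous_ip.comp (continuous_const.prodMk continuous_id)
  exact (continuous_ip.comp (continuous_id.prodMk continuous_id)).sub
    (continuous_finsetSum _ fun i _ => (h1 i).mul (h2 i))

variable {s v}

theorem norm_familyDefect_add_le (hv : ∀ x : Z, (0 : A) ≤ familyDefect s v x) (x y : Z) :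
    ‖(familyDefect s v (x + y) : A)‖ ≤ 2 * ‖(familyDefect s v x : A)‖ + 2 * ‖y‖ ^ 2 := by
  have h1 : (familyDefect s v (x + y) : A) ≤ (familyDefect s v x + familyDefect s v x) +
      (familyDefect s v y + familyDefect s v y) := by
    rw [← familyDefect_add_add_familyDefect_sub]
    exact le_add_of_nonneg_right (hv _)
  have h2 : ‖(familyDefect s v y : A)‖ ≤ ‖y‖ ^ 2 := by
    rw [norm_sq_eq (A := A)]
    exact CStarAlgebra.norm_le_norm_of_nonneg_of_le (hv y) (familyDefect_le_ip s v y)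
  calc ‖(familyDefect s v (x + y) : A)‖ ≤ _ :=
        CStarAlgebra.norm_le_norm_of_nonneg_of_le (hv _) h1
    _ ≤ (‖(familyDefect s v x : A)‖ + ‖(familyDefect s v x : A)‖) +
        (‖(familyDefect s v y : A)‖ + ‖(familyDefect s v y : A)‖) :=
        (norm_add_le _ _).trans (add_le_add (norm_add_le _ _) (norm_add_le _ _))
    _ ≤ _ := by linarith

end Family

variable [CStarCorrespondence A E] [CStarCorrespondence A F] [CStarCorrespondence A Z]

variable {m : E →ₗ[ℂ] F →ₗ[ℂ] Z}

/-- The defect of a family of elementary tensors, on a sum of elementary tensors. -/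
theorem IsInternalTensor.familyDefect_eq (hm : IsInternalTensor A m) {H : Finset E}
    {S : E →ₗ[ℂ] E} (hS : ∀ x y, (defect H x y : A) = ip (S x) (S y)) (G : Finset F)
    {n : ℕ} (ξ : Fin n → E) (ζ : Fin n → F) :
    (familyDefect (H ×ˢ G) (fun z => m z.1 z.2) (∑ j, m (ξ j) (ζ j)) : A) =
      ip (∑ j, m (S (ξ j)) (ζ j)) (∑ j, m (S (ξ j)) (ζ j)) +
        ∑ x ∈ H, defect G (∑ j, lact (ip x (ξ j) : A) (ζ j))
          (∑ j, lact (ip x (ξ j) : A) (ζ j)) := by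
  set y := ∑ j, m (ξ j) (ζ j) with hy
  set z : E → F := fun x => ∑ j, lact (ip x (ξ j) : A) (ζ j) with hz
  have h1 : ∀ x w, (ip (m x w) y : A) = ip w (z x) := fun x w => by
    simp only [hy, hz, ip_sum_right, hm.ip_eq]
  have h2 : ∀ x w, (ip y (m x w) : A) = ip (z x) w := fun x w => by
    rw [← star_ip, h1, star_ip]
  have h3 : (ip y y : A) = ∑ j, ∑ k, ip (ζ j) (lact (ip (ξ j) (ξ k) : A) (ζ k)) := by
    simp only [hy, ip_sum_left, ip_sum_right, hm.ip_eq]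
    exact Finset.sum_comm
  have h4 : ∀ x, (ip (z x) (z x) : A) =
      ∑ j, ∑ k, ip (ζ j) (lact (ip (ξ j) x * ip x (ξ k) : A) (ζ k)) := fun x => by
    simp only [hz, ip_sum_left, ip_sum_right, ip_lact_left, star_ip, lact_mul]
    exact Finset.sum_comm
  have h5 : (ip (∑ j, m (S (ξ j)) (ζ j)) (∑ j, m (S (ξ j)) (ζ j)) : A) =
      ip y y - ∑ x ∈ H, ip (z x) (z x) := by
    simp only [h3, h4]
    rw [Finset.sum_comm (s := H), ← Finset.sum_sub_distrib]
    simp only [ip_sum_left, ip_sum_right, hm.ip_eq]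
    rw [Finset.sum_comm]
    refine Finset.sum_congr rfl fun j _ => ?_
    rw [Finset.sum_comm (s := H), ← Finset.sum_sub_distrib]
    refine Finset.sum_congr rfl fun k _ => ?_
    rw [← hS, defect, map_sub, LinearMap.sub_apply, ip_sub_right, map_sum, LinearMap.sum_apply,
      ip_sum_right]
  rw [h5, familyDefect, Finset.sum_product]
  simp only [h1, h2, defect, Finset.sum_sub_distrib]
  abel

theorem IsInternalTensor.ip_lact (hm : IsInternalTensor A m)
    (hl : ∀ (a : A) ξ ζ, lact a (m ξ ζ) = m (lact a ξ) ζ) (a : A) (ξ : E) (ζ : F) :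
    (ip (m ξ ζ) (lact a (m ξ ζ)) : A) = ip ζ (lact (ip ξ (lact a ξ) : A) ζ) := by
  rw [hl, hm.ip_eq]

variable [StarOrderedRing A]

theorem ip_lact_le {d : A} (hd : 0 ≤ d) (x : F) : (ip x (lact d x) : A) ≤ ‖d‖ • ip x x := by
  have key : ∀ d : A, 0 ≤ d → ‖d‖ ≤ 1 → (ip x (lact d x) : A) ≤ ip x x := fun d hd hd1 => by
    obtain ⟨e, he, hed⟩ := exists_add_sub_mul_eq hd hd1
    have h0 : (0 : A) ≤ ip (x - lact e x) (x - lact e x) := ip_self_nonneg _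
    have h1 : (ip (x - lact e x) (x - lact e x) : A) = ip x x - ip x (lact d x) := by
      rw [← hed]
      simp only [ip_sub_left, ip_sub_right, ip_lact_left, he, map_add, map_sub,
        LinearMap.add_apply, LinearMap.sub_apply, lact_mul, ip_add_right]
      abel
    rw [h1] at h0
    exact sub_nonneg.1 h0
  rcases eq_or_ne d 0 with rfl | hne
  · simp [ip_zero_right]
  · have hn : 0 < ‖d‖ := norm_pos_iff.2 hne
    have h := key (‖d‖⁻¹ • d) (smul_nonneg (by positivity) hd) (by
      rw [norm_smul, norm_inv, norm_norm, inv_mul_cancel₀ hn.ne'])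
    have h2 : (ip x (lact (‖d‖⁻¹ • d) x) : A) = ‖d‖⁻¹ • ip x (lact d x) := by
      have h3 : (‖d‖⁻¹ • d : A) = ((‖d‖⁻¹ : ℝ) : ℂ) • d := (Complex.coe_smul _ _).symm
      rw [h3, map_smul, LinearMap.smul_apply, ip_smul_right, Complex.coe_smul]
    rw [h2] at h
    have h4 := smul_le_smul_of_nonneg_left h hn.le
    rwa [smul_smul, mul_inv_cancel₀ hn.ne', one_smul] at h4

theorem IsInternalTensor.norm_apply_le (hm : IsInternalTensor A m) (ξ : E) (ζ : F) :
    ‖m ξ ζ‖ ≤ ‖ξ‖ * ‖ζ‖ := by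
  have h1 : ‖m ξ ζ‖ ^ 2 ≤ (‖ξ‖ * ‖ζ‖) ^ 2 := by
    rw [norm_sq_eq (A := A), hm.ip_eq, mul_pow, norm_sq_eq (A := A) ξ, norm_sq_eq (A := A) ζ]
    refine (CStarAlgebra.norm_le_norm_of_nonneg_of_le (ip_lact_nonneg (ip_self_nonneg ξ) ζ)
      (ip_lact_le (ip_self_nonneg ξ) ζ)).trans (le_of_eq ?_)
    rw [norm_smul, norm_norm]
  exact (sq_le_sq₀ (norm_nonneg _) (by positivity)).1 h1

theorem IsInternalTensor.familyDefect_nonneg (hm : IsInternalTensor A m) {H : Finset E}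
    (hH : IsSplitSubframe A H) {G : Finset F} (hG : IsSubframe A G) (y : Z) :
    (0 : A) ≤ familyDefect (H ×ˢ G) (fun z => m z.1 z.2) y := by
  have hclosed : IsClosed {y : Z | (0 : A) ≤ familyDefect (H ×ˢ G) (fun z => m z.1 z.2) y} :=
    isClosed_Ici.preimage (continuous_familyDefect _ _)
  refine hclosed.closure_subset_iff.2 (fun y hy => ?_) (hm.dense_span y)
  obtain ⟨n, ξ, ζ, rfl⟩ := exists_eq_sum_of_mem_span hy
  obtain ⟨S, hS⟩ := hH
  rw [Set.mem_ofPred_eq, hm.familyDefect_eq hS]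
  exact add_nonneg (ip_self_nonneg _) (Finset.sum_nonneg fun x _ => hG.defect_nonneg _)

theorem IsInternalTensor.eventually_norm_familyDefect_le (hm : IsInternalTensor A m) (y : Z)
    {ε : ℝ} (hε : 0 < ε) :
    ∀ᶠ H in frameFilter A E, ∀ᶠ G in frameFilter A F,
      ‖(familyDefect (H ×ˢ G) (fun z => m z.1 z.2) y : A)‖ ≤ ε := by
  obtain ⟨y₀, hy₀, hyy₀⟩ : ∃ y₀ ∈ Submodule.span ℂ {y : Z | ∃ (ξ : E) (ζ : F), y = m ξ ζ},
      ‖y - y₀‖ ^ 2 < ε / 4 := by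
    obtain ⟨y₀, h1, h2⟩ := Metric.mem_closure_iff.1 (hm.dense_span y) (√(ε / 4)) (by positivity)
    refine ⟨y₀, h1, ?_⟩
    rw [dist_eq_norm] at h2
    exact (Real.lt_sqrt (norm_nonneg _)).1 h2
  obtain ⟨n, ξ, ζ, hsum⟩ := exists_eq_sum_of_mem_span hy₀
  have hlim : Tendsto (fun H : Finset E => (∑ j, √‖(defect H (ξ j) (ξ j) : A)‖ * ‖ζ j‖) ^ 2)
      (frameFilter A E) (𝓝 0) := by
    have h : ∀ j, Tendsto (fun H : Finset E => √‖(defect H (ξ j) (ξ j) : A)‖ * ‖ζ j‖)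
        (frameFilter A E) (𝓝 0) := fun j => by
      have := ((Real.continuous_sqrt.tendsto _).comp (tendsto_defect (A := A) (ξ j)).norm).mul_const
        ‖ζ j‖
      simpa using this
    have := (tendsto_finsetSum Finset.univ fun j _ => h j).pow 2
    simpa using this
  filter_upwards [(tendsto_order.1 hlim).2 (ε / 8) (by positivity), eventually_isSplitSubframe]
    with H hH hsplit
  have hlim' : Tendsto (fun G : Finset F => ‖(∑ x ∈ H, defect G
      (∑ j, lact (ip x (ξ j) : A) (ζ j)) (∑ j, lact (ip x (ξ j) : A) (ζ j)) : A)‖)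
      (frameFilter A F) (𝓝 0) := by
    have := (tendsto_finsetSum H fun x _ =>
      tendsto_defect (A := A) (∑ j, lact (ip x (ξ j) : A) (ζ j))).norm
    simpa using this
  filter_upwards [(tendsto_order.1 hlim').2 (ε / 8) (by positivity), eventually_isSplitSubframe]
    with G hG hGsplit
  have hnn := hm.familyDefect_nonneg hsplit hGsplit.isSubframe
  have h1 := norm_familyDefect_add_le hnn y₀ (y - y₀)
  rw [add_sub_cancel] at h1
  have h2 : ‖(familyDefect (H ×ˢ G) (fun z => m z.1 z.2) y₀ : A)‖ ≤ ε / 4 := by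
    obtain ⟨S, hS⟩ := hsplit
    rw [hsum, hm.familyDefect_eq hS]
    refine (norm_add_le _ _).trans ?_
    have h3 : ‖(ip (∑ j, m (S (ξ j)) (ζ j)) (∑ j, m (S (ξ j)) (ζ j)) : A)‖ ≤
        (∑ j, √‖(defect H (ξ j) (ξ j) : A)‖ * ‖ζ j‖) ^ 2 := by
      rw [← norm_sq_eq]
      gcongr
      refine (norm_sum_le _ _).trans (Finset.sum_le_sum fun j _ => ?_)
      rw [hS, ← norm_sq_eq, Real.sqrt_sq (norm_nonneg _)]
      exact hm.norm_apply_le _ _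
    linarith
  linarith

variable {τ : A → ℝ}

theorem IsInternalTensor.weightTrace_le (hm : IsInternalTensor A m)
    (hl : ∀ (a : A) ξ ζ, lact a (m ξ ζ) = m (lact a ξ) ζ) (hτ : IsTraceWeight τ)
    (hfin : ∀ b : A, 0 ≤ b → weightTrace F τ b ≠ ⊤) {a : A} (ha : 0 ≤ a) :
    weightTrace Z τ a ≤ weightTrace E (fun b => (weightTrace F τ b).toReal) a := by
  by_cases htop : weightTrace E (fun b => (weightTrace F τ b).toReal) a = ⊤
  · rw [htop]; exact le_top
  rw [← ENNReal.ofReal_toReal htop]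
  refine _root_.weightTrace_le fun V hV => le_of_forall_pos_le_add fun ε hε => ?_
  obtain ⟨c, -, hc, hc'⟩ := exists_star_mul_self_eq ha
  obtain ⟨C, hC⟩ := hτ.bound
  obtain ⟨δ, hδ, hδε⟩ : ∃ δ > 0, (V.card : ℝ) * (|C| * δ) ≤ ε := by
    refine ⟨ε / ((V.card : ℝ) * |C| + 1), by positivity, ?_⟩
    rw [← mul_assoc, mul_div_assoc', div_le_iff₀ (by positivity)]
    nlinarith
  have hev : ∀ᶠ H in frameFilter A E, ∀ᶠ G in frameFilter A F, ∀ v ∈ V,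
      ‖(familyDefect (H ×ˢ G) (fun z => m z.1 z.2) (lact c v) : A)‖ ≤ δ := by
    have h := (eventually_all_finset V).2 fun v _ =>
      hm.eventually_norm_familyDefect_le (lact c v) hδ
    exact h.mono fun H hH => (eventually_all_finset V).2 hH
  obtain ⟨H, hH, hHs⟩ := (hev.and eventually_isSplitSubframe).exists
  obtain ⟨G, hG, hGs⟩ := (hH.and eventually_isSplitSubframe).exists
  have hnn := hm.familyDefect_nonneg hHs hGs.isSubframe
  have h1 := hτ.sum_conj_le (H ×ˢ G) (fun z => m z.1 z.2) hnn hV c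
  rw [hc, hc'] at h1
  refine h1.trans (add_le_add ?_ ?_)
  · rw [Finset.sum_product]
    refine le_trans (Finset.sum_le_sum fun ξ _ => ?_)
      (sum_le_toReal_weightTrace htop hHs.isSubframe)
    simp only [hm.ip_lact hl]
    exact sum_le_toReal_weightTrace (hfin _ (ip_lact_nonneg ha ξ)) hGs.isSubframe
  · refine le_trans ?_ hδε
    rw [← nsmul_eq_mul]
    refine Finset.sum_le_card_nsmul _ _ _ fun v hv => (hC _ (hnn _)).trans ?_
    calc _ ≤ |C| * ‖(familyDefect (H ×ˢ G) (fun z => m z.1 z.2) (lact c v) : A)‖ := by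
          gcongr; exact le_abs_self C
      _ ≤ _ := by gcongr; exact hG v hv

theorem IsInternalTensor.sum_le_toReal_weightTrace (hm : IsInternalTensor A m)
    (hl : ∀ (a : A) ξ ζ, lact a (m ξ ζ) = m (lact a ξ) ζ) (hτ : IsTraceWeight τ)
    (hfin : ∀ b : A, 0 ≤ b → weightTrace F τ b ≠ ⊤) {a : A} (ha : 0 ≤ a)
    (hZ : weightTrace Z τ a ≠ ⊤) {H : Finset E} (hH : IsSplitSubframe A H) :
    ∑ ξ ∈ H, (weightTrace F τ (ip ξ (lact a ξ))).toReal ≤ (weightTrace Z τ a).toReal := by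
  have hlim := tendsto_finsetSum H fun ξ _ =>
    hτ.tendsto_weightTrace (E := F) (ip_lact_nonneg ha ξ) (hfin _ (ip_lact_nonneg ha ξ))
  refine le_of_tendsto hlim ?_
  filter_upwards [eventually_isSplitSubframe] with G hG
  obtain ⟨V, hV⟩ := exists_finset_sum_eq A (H ×ˢ G) (fun z => m z.1 z.2)
  have hsub : IsSubframe A V := (isSubframe_iff_sum_le V).2 fun x => by
    rw [hV _ (phaseInvariant_ip_mul_ip x x)]
    exact sub_nonneg.1 (hm.familyDefect_nonneg hH hG.isSubframe x)
  refine le_trans (le_of_eq ?_) (_root_.sum_le_toReal_weightTrace hZ hsub)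
  rw [← hτ.sum _ _ fun v _ => ip_lact_nonneg ha v, hV _ (phaseInvariant_ip_apply (lact a)),
    hτ.sum _ _ fun z _ => ip_lact_nonneg ha _, Finset.sum_product]
  simp only [hm.ip_lact hl]

/-- Induction in stages for traces. -/
theorem IsInternalTensor.weightTrace_eq (hm : IsInternalTensor A m)
    (hl : ∀ (a : A) ξ ζ, lact a (m ξ ζ) = m (lact a ξ) ζ) (hτ : IsTraceWeight τ)
    (hfin : ∀ b : A, 0 ≤ b → weightTrace F τ b ≠ ⊤)
    (hbound : ∃ C : ℝ, ∀ b : A, 0 ≤ b → (weightTrace F τ b).toReal ≤ C * ‖b‖)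
    {a : A} (ha : 0 ≤ a) :
    weightTrace Z τ a = weightTrace E (fun b => (weightTrace F τ b).toReal) a := by
  refine le_antisymm (hm.weightTrace_le hl hτ hfin ha) ?_
  by_cases htop : weightTrace Z τ a = ⊤
  · rw [htop]; exact le_top
  rw [← ENNReal.ofReal_toReal htop]
  have hσ : IsTraceWeight fun b => (weightTrace F τ b).toReal := hτ.weightTrace hfin hbound
  refine _root_.weightTrace_le fun H' hH' => ?_
  obtain ⟨c, -, hc, hc'⟩ := exists_star_mul_self_eq ha
  have hd := (hσ.tendsto_sum_defect H' (fun ξ => lact c ξ)).const_add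
    (weightTrace Z τ a).toReal
  rw [add_zero] at hd
  refine ge_of_tendsto hd ?_
  filter_upwards [eventually_isSplitSubframe] with H hH
  have h := hσ.sum_le_sum_add_defect hH.isSubframe hH' c
  rw [hc, hc'] at h
  exact h.trans (by
    gcongr
    exact hm.sum_le_toReal_weightTrace hl hτ hfin ha htop hH)

/-- The trace induced by the trivial correspondence. -/
theorem weightTrace_trivial (hτ : IsTraceWeight τ) (U : A ≃ₗ[ℂ] E)
    (hip : ∀ a b : A, ip (U a) (U b) = star a * b) (hl : ∀ a b : A, lact a (U b) = U (a * b))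
    {a : A} (ha : 0 ≤ a) : weightTrace E τ a = ENNReal.ofReal (τ a) := by
  obtain ⟨b, hb, hba, -⟩ := exists_star_mul_self_eq ha
  have h1 : ∀ ξ : E, τ (ip ξ (lact a ξ)) = τ (ip (U b) ξ * ip ξ (U b)) := fun ξ => by
    obtain ⟨z, rfl⟩ := U.surjective ξ
    have h := hτ.trace (b * z)
    rw [hl, hip, hip, hip, ← hba]
    simpa only [star_mul, hb, mul_assoc] using h
  have h2 : ∀ H : Finset E, IsSubframe A H →
      ∑ ξ ∈ H, τ (ip ξ (lact a ξ)) + τ (defect H (U b) (U b)) = τ a := fun H hH => by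
    have h3 := sum_add_defect (A := A) H (U b) (U b)
    rw [hip, hba] at h3
    rw [Finset.sum_congr rfl fun ξ _ => h1 ξ, ← hτ.sum _ _ fun ξ _ => ip_mul_ip_nonneg _ _,
      ← hτ.add _ _ (Finset.sum_nonneg fun ξ _ => ip_mul_ip_nonneg _ _) (hH.defect_nonneg _), h3]
  have hle : weightTrace E τ a ≤ ENNReal.ofReal (τ a) := weightTrace_le fun H hH => by
    linarith [h2 H hH, hτ.nonneg _ (hH.defect_nonneg (U b))]
  have hfin : weightTrace E τ a ≠ ⊤ := ne_top_of_le_ne_top ENNReal.ofReal_ne_top hle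
  rw [← ENNReal.ofReal_toReal hfin]
  congr 1
  refine tendsto_nhds_unique (hτ.tendsto_weightTrace ha hfin) ?_
  have hd : Tendsto (fun H : Finset E => τ a - τ (defect H (U b) (U b))) (frameFilter A E)
      (𝓝 (τ a - 0)) := tendsto_const_nhds.sub (hτ.tendsto_zero
        (eventually_isSplitSubframe.mono fun H hH => hH.isSubframe.defect_nonneg _)
        (tendsto_defect (U b)))
  rw [sub_zero] at hd
  refine hd.congr' ?_
  filter_upwards [eventually_isSplitSubframe] with H hH
  linarith [h2 H hH.isSubframe]

end Tensor

section Combinatorics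

variable {M : Type*}

/-- The value of `φ` on the formal product of `S` and all `1 - C`, for `C` in the list. -/
def alternatingSum (φ : Set M → ℝ) : List (Set M) → Set M → ℝ
  | [], S => φ S
  | C :: L, S => alternatingSum φ L S - alternatingSum φ L (S ∩ C)

theorem alternatingSum_perm (φ : Set M → ℝ) {L L' : List (Set M)} (h : L.Perm L') (S : Set M) :
    alternatingSum φ L S = alternatingSum φ L' S := by
  induction h generalizing S with
  | nil => rfl
  | cons C _ ih => simp only [alternatingSum, ih]
  | swap C D L =>
    simp only [alternatingSum, Set.inter_right_comm S C D]
    ring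
  | trans _ _ ih ih' => rw [ih, ih']

theorem alternatingSum_empty {φ : Set M → ℝ} (hφ : φ ∅ = 0) (L : List (Set M)) :
    alternatingSum φ L ∅ = 0 := by
  induction L with
  | nil => exact hφ
  | cons C L ih => simp [alternatingSum, ih]

variable [Monoid M]

/-- The right ideal generated by `r`. -/
def rightMultiples (r : M) : Set M := {m | r ∣ m}

/-- The common right multiples of a finite set. -/
def commonMultiples (K : Finset M) : Set M := {m | ∀ k ∈ K, k ∣ m}

theorem isRightLCM_iff (K : Finset M) (r : M) :
    IsRightLCM (K : Set M) r ↔ commonMultiples K = rightMultiples r := by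
  constructor
  · rintro ⟨h1, h2⟩
    ext m
    exact ⟨fun hm => h2 m hm, fun hm k hk => (h1 k hk).trans hm⟩
  · intro h
    have hr : r ∈ commonMultiples K := h ▸ (dvd_refl r : r ∈ rightMultiples r)
    exact ⟨hr, fun m hm => (h ▸ (hm : m ∈ commonMultiples K) : m ∈ rightMultiples r)⟩

/-- The alternating sum over the subsets of a finite set of generators. -/
def inclusionExclusion (φ : Set M → ℝ) (J : Finset M) (S : Set M) : ℝ :=
  ∑ K ∈ J.powerset, (-1) ^ K.card * φ (S ∩ commonMultiples K)

theorem inclusionExclusion_insert [DecidableEq M] (φ : Set M → ℝ) (p : M) (J : Finset M)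
    (S : Set M) :
    inclusionExclusion φ (insert p J) S =
      inclusionExclusion φ J S - inclusionExclusion φ J (S ∩ rightMultiples p) := by
  have key : ∀ J : Finset M, p ∉ J → ∀ S, inclusionExclusion φ (insert p J) S =
      inclusionExclusion φ J S - inclusionExclusion φ J (S ∩ rightMultiples p) := by
    intro J hp S
    rw [inclusionExclusion, Finset.sum_powerset_insert hp, inclusionExclusion, inclusionExclusion,
      sub_eq_add_neg, ← Finset.sum_neg_distrib]
    congr 1
    refine Finset.sum_congr rfl fun K hK => ?_
    have hpK : p ∉ K := fun h => hp (Finset.mem_powerset.1 hK h)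
    have hset : S ∩ commonMultiples (insert p K) = S ∩ rightMultiples p ∩ commonMultiples K := by
      ext m
      simp [commonMultiples, rightMultiples, and_assoc]
    rw [Finset.card_insert_of_notMem hpK, hset, pow_succ]
    ring
  by_cases hp : p ∈ J
  · have h1 := key (J.erase p) (Finset.notMem_erase p J) (S ∩ rightMultiples p)
    rw [Finset.insert_erase hp, Set.inter_assoc, Set.inter_self, sub_self] at h1
    rw [Finset.insert_eq_of_mem hp, h1, sub_zero]
  · exact key J hp S

theorem exists_alternatingSum_eq (J : Finset M) :
    ∃ L : List (Set M), (∀ C ∈ L, ∃ r, C = rightMultiples r) ∧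
      ∀ (φ : Set M → ℝ) (S : Set M), inclusionExclusion φ J S = alternatingSum φ L S := by
  classical
  induction J using Finset.induction_on with
  | empty => exact ⟨[], by simp, fun φ S => by simp [inclusionExclusion, alternatingSum,
      commonMultiples]⟩
  | insert p J _ ih =>
    obtain ⟨L, hL, h⟩ := ih
    refine ⟨rightMultiples p :: L, ?_, fun φ S => ?_⟩
    · rintro C (_ | ⟨_, hC⟩)
      exacts [⟨p, rfl⟩, hL C hC]
    · rw [inclusionExclusion_insert, h, h, alternatingSum]

theorem exists_inclusionExclusion_eq {R : Set M} (L : List (Set M))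
    (hL : ∀ C ∈ L, C = ∅ ∨ ∃ r ∈ R, C = rightMultiples r) :
    ∃ J : Finset M, (J : Set M) ⊆ R ∧ ∀ φ : Set M → ℝ, φ ∅ = 0 → ∀ S,
      alternatingSum φ L S = inclusionExclusion φ J S := by
  classical
  induction L with
  | nil => exact ⟨∅, by simp, fun φ _ S => by simp [inclusionExclusion, alternatingSum,
      commonMultiples]⟩
  | cons C L ih =>
    obtain ⟨J, hJ, h⟩ := ih fun D hD => hL D (List.mem_cons_of_mem C hD)
    rcases hL C List.mem_cons_self with rfl | ⟨r, hr, rfl⟩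
    · refine ⟨J, hJ, fun φ hφ S => ?_⟩
      rw [alternatingSum, Set.inter_empty, alternatingSum_empty hφ, sub_zero, h φ hφ]
    · refine ⟨insert r J, ?_, fun φ hφ S => ?_⟩
      · rw [Finset.coe_insert]
        exact Set.insert_subset hr hJ
      · rw [alternatingSum, h φ hφ, h φ hφ, inclusionExclusion_insert]

theorem image_rightMultiples (x q : M) :
    (x * ·) '' rightMultiples q = rightMultiples (x * q) := by
  ext m
  constructor
  · rintro ⟨_, ⟨c, rfl⟩, rfl⟩
    exact ⟨c, (mul_assoc x q c).symm⟩
  · rintro ⟨c, rfl⟩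
    exact ⟨q * c, ⟨c, rfl⟩, (mul_assoc x q c).symm⟩

theorem image_mul_univ (x : M) : (x * ·) '' Set.univ = rightMultiples x := by
  ext m
  exact ⟨fun ⟨c, _, h⟩ => ⟨c, h.symm⟩, fun ⟨c, h⟩ => ⟨c, trivial, h.symm⟩⟩

theorem rightMultiples_one : rightMultiples (1 : M) = Set.univ := by
  ext m
  exact ⟨fun _ => trivial, fun _ => one_dvd m⟩

theorem tendsto_alternatingSum_image {B : Type*} {φ : B → Set M → ℝ} {b : B} {x : M}
    {l : Filter ((B → ℝ) →ₗ[ℝ] ℝ)}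
    (h : ∀ S, Tendsto (fun T : (B → ℝ) →ₗ[ℝ] ℝ => T fun b' => φ b' S) l (𝓝 (φ b ((x * ·) '' S))))
    (L : List (Set M)) (S : Set M) :
    Tendsto (fun T : (B → ℝ) →ₗ[ℝ] ℝ =>
        T fun b' => alternatingSum (φ b') (L.map ((x * ·) ⁻¹' ·)) S) l
      (𝓝 (alternatingSum (φ b) L ((x * ·) '' S))) := by
  induction L generalizing S with
  | nil => exact h S
  | cons C L ih =>
    have h1 := (ih S).sub (ih (S ∩ (x * ·) ⁻¹' C))
    rw [Set.image_inter_preimage] at h1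
    refine h1.congr fun T => ?_
    rw [← map_sub]
    rfl

theorem inclusionExclusion_eq_zero_of_one_mem (φ : Set M → ℝ) {J : Finset M} (h : 1 ∈ J) :
    inclusionExclusion φ J Set.univ = 0 := by
  classical
  have h1 := inclusionExclusion_insert φ 1 J Set.univ
  rwa [Finset.insert_eq_of_mem h, rightMultiples_one, Set.inter_self, sub_self] at h1

section Noetherian

theorem IsNoetherianMonoid.wellFounded (hN : IsNoetherianMonoid M) :
    WellFounded (IsProperFactor : M → M → Prop) := by
  rw [wellFounded_iff_isEmpty_descending_chain]
  exact ⟨fun f => hN ⟨f.1, f.2⟩⟩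

theorem isProperFactor_mul_left {x : M} (hx : ¬ IsUnit x) (q : M) : IsProperFactor q (x * q) :=
  ⟨x, 1, (mul_one _).symm, Or.inl hx⟩

theorem isProperFactor_mul_right {y : M} (hy : ¬ IsUnit y) (q : M) : IsProperFactor q (q * y) :=
  ⟨1, y, by rw [one_mul], Or.inr hy⟩

theorem IsNoetherianMonoid.exists_irreducible_mul (hN : IsNoetherianMonoid M) {p : M}
    (hp : ¬ IsUnit p) : ∃ x q, Irreducible x ∧ p = x * q := by
  induction p using hN.wellFounded.induction with
  | _ p ih =>
    by_cases hirr : Irreducible p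
    · exact ⟨p, 1, hirr, (mul_one p).symm⟩
    · rw [irreducible_iff] at hirr
      push Not at hirr
      obtain ⟨g, h, hgh, hg, hh⟩ := hirr hp
      obtain ⟨x, q, hx, rfl⟩ := ih g (hgh ▸ isProperFactor_mul_right hh g) hg
      exact ⟨x, q * h, hx, by rw [hgh, mul_assoc]⟩

variable [IsLeftCancelMul M]

theorem rightMultiples_injective (hunit : ∀ u : M, IsUnit u → u = 1) :
    Function.Injective (rightMultiples : M → Set M) := by
  intro r s h
  obtain ⟨c, rfl⟩ : r ∣ s := by
    have : s ∈ rightMultiples s := dvd_refl s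
    rwa [← h] at this
  obtain ⟨d, hd⟩ : r * c ∣ r := by
    have : r ∈ rightMultiples r := dvd_refl r
    rwa [h] at this
  have h1 : c * d = 1 := by
    refine mul_left_cancel (a := r) ?_
    rw [mul_one, ← mul_assoc, ← hd]
  have h2 : d * c = 1 := by
    refine mul_left_cancel (a := c) ?_
    rw [mul_one, ← mul_assoc, h1, one_mul]
  rw [hunit c ⟨⟨c, d, h1, h2⟩, rfl⟩, mul_one]

theorem preimage_rightMultiples_mul (x q : M) :
    (x * ·) ⁻¹' rightMultiples (x * q) = rightMultiples q := by
  rw [← image_rightMultiples, Set.preimage_image_eq _ (mul_right_injective x)]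

theorem preimage_rightMultiples
    (hlcm : ∀ p q : M, (∃ r, p ∣ r ∧ q ∣ r) → ∃ r, IsRightLCM {p, q} r) (x p : M) :
    (x * ·) ⁻¹' rightMultiples p = ∅ ∨
      ∃ r, IsRightLCM {x, p} (x * r) ∧ (x * ·) ⁻¹' rightMultiples p = rightMultiples r := by
  rcases Set.eq_empty_or_nonempty ((x * ·) ⁻¹' rightMultiples p) with h | ⟨m, hm⟩
  · exact Or.inl h
  · right
    obtain ⟨s, hs⟩ := hlcm x p ⟨x * m, dvd_mul_right x m, hm⟩
    obtain ⟨r, rfl⟩ := hs.1 x (by simp)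
    refine ⟨r, hs, ?_⟩
    rw [← preimage_rightMultiples_mul x r]
    ext n
    refine ⟨fun hn => hs.2 _ ?_, fun hn => (hs.1 p (by simp)).trans hn⟩
    rintro u (rfl | rfl)
    exacts [dvd_mul_right _ n, hn]

/-- Positivity of the alternating sums passes from the minimal set to all elements. -/
theorem inclusionExclusion_nonneg_of_PInf
    (hlcm : ∀ p q : M, (∃ r, p ∣ r ∧ q ∣ r) → ∃ r, IsRightLCM {p, q} r)
    (hunit : ∀ u : M, IsUnit u → u = 1) (hN : IsNoetherianMonoid M)
    {B : Type*} {φ : B → Set M → ℝ} (hφ : ∀ b, φ b ∅ = 0)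
    (hshift : ∀ x : M, Irreducible x → ∀ b, ∃ l : Filter ((B → ℝ) →ₗ[ℝ] ℝ), l.NeBot ∧
      (∀ᶠ T in l, ∀ g : B → ℝ, 0 ≤ g → 0 ≤ T g) ∧
      ∀ S, Tendsto (fun T : (B → ℝ) →ₗ[ℝ] ℝ => T fun b' => φ b' S) l (𝓝 (φ b ((x * ·) '' S))))
    (hpos : ∀ J : Finset M, (J : Set M) ⊆ PInf M → ∀ b, 0 ≤ inclusionExclusion (φ b) J Set.univ)
    (J : Finset M) (b : B) : 0 ≤ inclusionExclusion (φ b) J Set.univ := by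
  have main : ∀ (n : ℕ) (L₂ L₁ : List (Set M)), L₂.length = n →
      (∀ C ∈ L₂, C = ∅ ∨ ∃ r, C = rightMultiples r) →
      (∀ C ∈ L₁, C = ∅ ∨ ∃ r ∈ PInf M, C = rightMultiples r) →
      ∀ b, 0 ≤ alternatingSum (φ b) (L₂ ++ L₁) Set.univ := by
    intro n
    induction n with
    | zero =>
      intro L₂ L₁ hlen _ h₁ b
      rw [List.length_eq_zero_iff.1 hlen, List.nil_append]
      obtain ⟨J, hJ, h⟩ := exists_inclusionExclusion_eq L₁ h₁
      rw [h _ (hφ b)]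
      exact hpos J hJ b
    | succ n ihn =>
      have step : ∀ (p : M) (L₂ L₁ : List (Set M)), L₂.length = n →
          (∀ C ∈ L₂, C = ∅ ∨ ∃ r, C = rightMultiples r) →
          (∀ C ∈ L₁, C = ∅ ∨ ∃ r ∈ PInf M, C = rightMultiples r) →
          ∀ b, 0 ≤ alternatingSum (φ b) (rightMultiples p :: (L₂ ++ L₁)) Set.univ := by
        intro p
        induction p using hN.wellFounded.induction with
        | _ p ihp =>
          intro L₂ L₁ hlen h₂ h₁ b
          by_cases hp : IsUnit p
          · rw [hunit p hp, rightMultiples_one, alternatingSum, Set.inter_self, sub_self]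
          obtain ⟨x, q, hx, rfl⟩ := hN.exists_irreducible_mul hp
          have hsub : rightMultiples (x * q) ⊆ rightMultiples x := fun m hm =>
            (dvd_mul_right x q).trans hm
          have hsplit : alternatingSum (φ b) (rightMultiples (x * q) :: (L₂ ++ L₁)) Set.univ =
              alternatingSum (φ b) (rightMultiples x :: (L₂ ++ L₁)) Set.univ +
              alternatingSum (φ b) (rightMultiples (x * q) :: (L₂ ++ L₁))
                ((x * ·) '' Set.univ) := by
            simp only [alternatingSum, Set.univ_inter, image_mul_univ,
              Set.inter_eq_self_of_subset_right hsub]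
            ring
          rw [hsplit]
          refine add_nonneg ?_ ?_
          · rw [alternatingSum_perm (φ b) (List.perm_middle (l₁ := L₂)).symm]
            refine ihn L₂ _ hlen h₂ (fun C hC => ?_) b
            rcases List.mem_cons.1 hC with rfl | hC
            · exact Or.inr ⟨x, MemPInf.atom x hx, rfl⟩
            · exact h₁ C hC
          · obtain ⟨l, hl, hlpos, hlim⟩ := hshift x hx b
            refine ge_of_tendsto (tendsto_alternatingSum_image hlim _ _) ?_
            filter_upwards [hlpos] with T hT
            refine hT _ fun b' => ?_
            rw [List.map_cons, List.map_append, preimage_rightMultiples_mul]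
            refine ihp q (isProperFactor_mul_left hx.not_isUnit q) _ _ (by simpa using hlen)
              (fun C hC => ?_) (fun C hC => ?_) b'
            · obtain ⟨D, hD, rfl⟩ := List.mem_map.1 hC
              rcases h₂ D hD with rfl | ⟨r, rfl⟩
              · exact Or.inl rfl
              · exact (preimage_rightMultiples hlcm x r).imp_right fun ⟨s, _, h⟩ => ⟨s, h⟩
            · obtain ⟨D, hD, rfl⟩ := List.mem_map.1 hC
              rcases h₁ D hD with rfl | ⟨r, hr, rfl⟩
              · exact Or.inl rfl
              · exact (preimage_rightMultiples hlcm x r).imp_right fun ⟨s, hs, h⟩ =>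
                  ⟨s, MemPInf.step x r s hx hr hs, h⟩
      intro L₂ L₁ hlen h₂ h₁ b
      obtain ⟨C, L₂, rfl⟩ := List.exists_cons_of_length_eq_add_one hlen
      have hlen' : L₂.length = n := by simpa using hlen
      have h₂' : ∀ C ∈ L₂, C = ∅ ∨ ∃ r, C = rightMultiples r := fun D hD =>
        h₂ D (List.mem_cons_of_mem C hD)
      rcases h₂ C List.mem_cons_self with rfl | ⟨p, rfl⟩
      · rw [List.cons_append, alternatingSum, Set.inter_empty, alternatingSum_empty (hφ b),
          sub_zero]
        exact ihn L₂ L₁ hlen' h₂' h₁ b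
      · exact step p L₂ L₁ hlen' h₂' h₁ b
  obtain ⟨L, hL, h⟩ := exists_alternatingSum_eq J
  rw [h]
  have := main L.length L [] rfl (fun C hC => Or.inr (hL C hC)) (by simp) b
  rwa [List.append_nil] at this

end Noetherian

end Combinatorics

section Positivity

variable {A : Type*} [NonUnitalCStarAlgebra A] [PartialOrder A]
  {M : Type*} [Monoid M]
  (X : M → Type*) [∀ p, NormedAddCommGroup (X p)] [∀ p, NormedSpace ℂ (X p)]
  [∀ p, CompleteSpace (X p)] [∀ p, CStarCorrespondence A (X p)]
  (N : M →* ℝ) (β : ℝ) (τ : A →L[ℂ] ℂ)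

/-- The number `N(r)^{-β} Tr_τ^r(a)`. -/
noncomputable def scaledTrace (r : M) (a : A) : ℝ :=
  N r ^ (-β) * (weightTrace (X r) (fun b => (τ b).re) a).toReal

open Classical in
/-- The function `r M ↦ N(r)^{-β} Tr_τ^r(a)` on the principal right ideals, extended by zero. -/
noncomputable def idealTrace (a : A) (S : Set M) : ℝ :=
  if h : ∃ r, S = rightMultiples r then scaledTrace X N β τ h.choose a else 0

theorem idealTrace_empty (a : A) : idealTrace X N β τ a ∅ = 0 := by
  rw [idealTrace, dif_neg]
  rintro ⟨r, hr⟩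
  have : r ∈ rightMultiples r := dvd_refl r
  rw [← hr] at this
  exact this

theorem idealTrace_rightMultiples (hinj : Function.Injective (rightMultiples : M → Set M))
    (a : A) (r : M) : idealTrace X N β τ a (rightMultiples r) = scaledTrace X N β τ r a := by
  have h : ∃ s, rightMultiples r = rightMultiples s := ⟨r, rfl⟩
  rw [idealTrace, dif_pos h, ← hinj h.choose_spec]

theorem joinTerm_of_isRightLCM (hinj : Function.Injective (rightMultiples : M → Set M))
    (a : A) {K : Finset M} {r : M} (hr : IsRightLCM (K : Set M) r) :
    joinTerm X N β τ a K =
      ENNReal.ofReal (N r ^ (-β)) * weightTrace (X r) (fun b => (τ b).re) a := by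
  have h : ∃ s, IsRightLCM (K : Set M) s := ⟨r, hr⟩
  have hs : h.choose = r :=
    hinj (((isRightLCM_iff K _).1 h.choose_spec).symm.trans ((isRightLCM_iff K r).1 hr))
  rw [joinTerm, dif_pos h]
  exact congrArg (fun s => ENNReal.ofReal (N s ^ (-β)) *
    weightTrace (X s) (fun b => (τ b).re) a) hs

theorem EReal.coe_sum_real {ι : Type*} (s : Finset ι) (f : ι → ℝ) :
    ((∑ i ∈ s, f i : ℝ) : EReal) = ∑ i ∈ s, (f i : EReal) := by
  classical
  induction s using Finset.induction_on with
  | empty => simp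
  | insert i s hi ih => rw [Finset.sum_insert hi, Finset.sum_insert hi, EReal.coe_add, ih]

variable {X N β τ}

theorem coe_joinTerm (hinj : Function.Injective (rightMultiples : M → Set M))
    (hN : ∀ p, 0 < N p) {a : A}
    (hfin : ∀ r, weightTrace (X r) (fun b => (τ b).re) a ≠ ⊤) (K : Finset M) :
    (joinTerm X N β τ a K : EReal) = (idealTrace X N β τ a (commonMultiples K) : ℝ) := by
  by_cases h : ∃ r, IsRightLCM (K : Set M) r
  · obtain ⟨r, hr⟩ := h
    rw [joinTerm_of_isRightLCM X N β τ hinj a hr, (isRightLCM_iff K r).1 hr,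
      idealTrace_rightMultiples X N β τ hinj, scaledTrace]
    rw [← ENNReal.ofReal_toReal (hfin r), ← ENNReal.ofReal_mul (Real.rpow_nonneg (hN r).le _),
      EReal.coe_ennreal_ofReal, ENNReal.toReal_ofReal ENNReal.toReal_nonneg, max_eq_left]
    exact mul_nonneg (Real.rpow_nonneg (hN r).le _) ENNReal.toReal_nonneg
  · rw [joinTerm, dif_neg h, idealTrace, dif_neg]
    · simp
    · rintro ⟨r, hr⟩
      exact h ⟨r, (isRightLCM_iff K r).2 hr⟩

theorem commonMultiples_singleton (p : M) : commonMultiples {p} = rightMultiples p := by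
  ext m
  simp [commonMultiples, rightMultiples]

theorem commonMultiples_empty : commonMultiples (∅ : Finset M) = rightMultiples 1 := by
  ext m
  simp [commonMultiples, rightMultiples]

/-- If the induced traces are finite, the positivity condition is about real numbers. -/
theorem positivitySum_eq_inclusionExclusion
    (hinj : Function.Injective (rightMultiples : M → Set M)) (hN : ∀ p, 0 < N p) {a : A}
    (hfin : ∀ r, weightTrace (X r) (fun b => (τ b).re) a ≠ ⊤)
    (hone : weightTrace (X 1) (fun b => (τ b).re) a = ENNReal.ofReal (τ a).re)
    (hτa : 0 ≤ (τ a).re) (J : Finset M) :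
    positivitySum X N β τ J a =
      (inclusionExclusion (idealTrace X N β τ a) J Set.univ : ℝ) := by
  have h0 : (τ a).re = idealTrace X N β τ a (commonMultiples ∅) := by
    rw [commonMultiples_empty, idealTrace_rightMultiples X N β τ hinj, scaledTrace, hone,
      ENNReal.toReal_ofReal hτa]
    simp
  have hsplit : inclusionExclusion (idealTrace X N β τ a) J Set.univ =
      (τ a).re + ∑ K ∈ J.powerset with K.Nonempty,
        (-1) ^ K.card * idealTrace X N β τ a (commonMultiples K) := by
    classical
    rw [inclusionExclusion, ← Finset.sum_filter_add_sum_filter_not J.powerset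
      (fun K => K.Nonempty), add_comm]
    simp only [Set.univ_inter]
    congr 1
    have : J.powerset.filter (fun K => ¬ K.Nonempty) = {∅} := by
      ext K
      simp only [Finset.mem_filter, Finset.mem_powerset, Finset.not_nonempty_iff_eq_empty,
        Finset.mem_singleton]
      exact ⟨fun h => h.2, fun h => ⟨h ▸ Finset.empty_subset J, h⟩⟩
    rw [this, Finset.sum_singleton, Finset.card_empty, pow_zero, one_mul, h0]
  rw [hsplit, EReal.coe_add, EReal.coe_sum_real, positivitySum]
  congr 1
  refine Finset.sum_congr rfl fun K _ => ?_
  rw [coe_joinTerm hinj hN hfin, EReal.coe_mul, EReal.coe_pow]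
  simp

theorem joinTerm_singleton_le {p : M} {a : A} (h : 0 ≤ positivitySum X N β τ {p} a) :
    joinTerm X N β τ a {p} ≤ ENNReal.ofReal (τ a).re := by
  have hset : ({p} : Finset M).powerset.filter (fun K => K.Nonempty) = {{p}} := by
    classical
    ext K
    simp only [Finset.mem_filter, Finset.mem_powerset, Finset.subset_singleton_iff,
      Finset.mem_singleton]
    constructor
    · rintro ⟨rfl | rfl, h⟩
      · simp at h
      · rfl
    · rintro rfl
      simp
  rw [positivitySum, hset, Finset.sum_singleton, Finset.card_singleton, pow_one, neg_one_mul,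
    ← sub_eq_add_neg] at h
  by_cases htop : joinTerm X N β τ a {p} = ⊤
  · rw [htop] at h
    simp at h
  · lift joinTerm X N β τ a {p} to NNReal using htop with t
    have h1 : (0 : ℝ) ≤ (τ a).re - t := EReal.coe_nonneg.1 (by rw [EReal.coe_sub]; exact h)
    rw [← ENNReal.ofReal_coe_nnreal]
    exact ENNReal.ofReal_le_ofReal (by linarith)

theorem weightTrace_le_of_positivitySum
    (hinj : Function.Injective (rightMultiples : M → Set M)) (hN : ∀ p, 0 < N p)
    {p : M} {a : A} (h : 0 ≤ positivitySum X N β τ {p} a) :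
    weightTrace (X p) (fun b => (τ b).re) a ≤ ENNReal.ofReal ((N p ^ (-β))⁻¹ * (τ a).re) := by
  have hc : 0 < N p ^ (-β) := Real.rpow_pos_of_pos (hN p) _
  have h1 := joinTerm_singleton_le h
  rw [joinTerm_of_isRightLCM X N β τ hinj a
    ((isRightLCM_iff {p} p).2 (commonMultiples_singleton p))] at h1
  rw [ENNReal.ofReal_mul (by positivity), ENNReal.ofReal_inv_of_pos hc]
  rwa [← ENNReal.mul_le_iff_le_inv (by simpa using hc) ENNReal.ofReal_ne_top]

theorem ProductSystem.lact_mul_eq (Y : ProductSystem A X) {p q r : M} (h : p * q = r) (a : A)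
    (x : X p) (y : X q) : lact a (Y.mul h x y) = Y.mul h (lact a x) y := by
  rw [← Y.unit_mul, ← Y.unit_mul, Y.mul_assoc (one_mul p) h h (one_mul r)]

variable [StarOrderedRing A]

theorem ProductSystem.weightTrace_one (Y : ProductSystem A X) (hτ : IsTracialState τ) {a : A}
    (ha : 0 ≤ a) :
    weightTrace (X 1) (fun b => (τ b).re) a = ENNReal.ofReal (τ a).re :=
  weightTrace_trivial hτ.isTraceWeight Y.unit Y.ip_unit Y.lact_unit ha

/-- The bound on the traces induced by the irreducible elements extends to all elements. -/
theorem ProductSystem.weightTrace_le_of_irreducible (Y : ProductSystem A X)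
    (hNoeth : IsNoetherianMonoid M) (hunit : ∀ u : M, IsUnit u → u = 1) (hN : ∀ p, 0 < N p)
    (hτ : IsTracialState τ)
    (hirr : ∀ x : M, Irreducible x → ∀ a : A, 0 ≤ a →
      weightTrace (X x) (fun b => (τ b).re) a ≤ ENNReal.ofReal ((N x ^ (-β))⁻¹ * (τ a).re))
    (p : M) (a : A) (ha : 0 ≤ a) :
    weightTrace (X p) (fun b => (τ b).re) a ≤ ENNReal.ofReal ((N p ^ (-β))⁻¹ * (τ a).re) := by
  induction p using hNoeth.wellFounded.induction generalizing a with
  | _ p ih =>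
    by_cases hp : IsUnit p
    · obtain rfl := hunit p hp
      rw [Y.weightTrace_one hτ ha]
      simp
    obtain ⟨x, q, hx, rfl⟩ := hNoeth.exists_irreducible_mul hp
    have hq := ih q (isProperFactor_mul_left hx.not_isUnit q)
    have hfin : ∀ b : A, 0 ≤ b → weightTrace (X q) (fun b => (τ b).re) b ≠ ⊤ := fun b hb =>
      ne_top_of_le_ne_top ENNReal.ofReal_ne_top (hq b hb)
    have hx1 : x ≠ 1 := fun h => hx.not_isUnit (h ▸ isUnit_one)
    have hcq : 0 < N q ^ (-β) := Real.rpow_pos_of_pos (hN q) _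
    have hcx : 0 < N x ^ (-β) := Real.rpow_pos_of_pos (hN x) _
    have hw := hτ.isTraceWeight
    refine ((Y.isTensor rfl hx1).weightTrace_le (Y.lact_mul_eq rfl) hw hfin ha).trans
      (weightTrace_le fun H hH => ?_)
    have hxfin : weightTrace (X x) (fun b => (τ b).re) a ≠ ⊤ :=
      ne_top_of_le_ne_top ENNReal.ofReal_ne_top (hirr x hx a ha)
    calc _ ≤ ∑ ξ ∈ H, (N q ^ (-β))⁻¹ * (τ (ip ξ (lact a ξ))).re := by
          refine Finset.sum_le_sum fun ξ _ => ?_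
          have hpos := ip_lact_nonneg (A := A) ha ξ
          exact ENNReal.toReal_le_of_le_ofReal
            (mul_nonneg (by positivity) (hw.nonneg _ hpos)) (hq _ hpos)
      _ = (N q ^ (-β))⁻¹ * ∑ ξ ∈ H, (τ (ip ξ (lact a ξ))).re := by rw [Finset.mul_sum]
      _ ≤ (N q ^ (-β))⁻¹ * ((N x ^ (-β))⁻¹ * (τ a).re) := by
          gcongr
          exact (sum_le_toReal_weightTrace hxfin hH).trans (ENNReal.toReal_le_of_le_ofReal
            (mul_nonneg (by positivity) (hw.nonneg a ha)) (hirr x hx a ha))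
      _ = _ := by
          rw [map_mul, Real.mul_rpow (hN x).le (hN q).le, mul_inv]
          ring

/-- Passing from `q` to `x q` is a limit of positive combinations. -/
theorem ProductSystem.tendsto_scaledTrace (Y : ProductSystem A X) (hN : ∀ p, 0 < N p)
    (hτ : IsTracialState τ)
    (hle : ∀ (p : M) (a : A), 0 ≤ a →
      weightTrace (X p) (fun b => (τ b).re) a ≤ ENNReal.ofReal ((N p ^ (-β))⁻¹ * (τ a).re))
    {x : M} (hx : x ≠ 1) (q : M) {a : A} (ha : 0 ≤ a) :
    Tendsto (fun H : Finset (X x) =>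
        N x ^ (-β) * ∑ ξ ∈ H, scaledTrace X N β τ q (ip ξ (lact a ξ)))
      (frameFilter A (X x)) (𝓝 (scaledTrace X N β τ (x * q) a)) := by
  have hw := hτ.isTraceWeight
  have hfin : ∀ (p : M) (b : A), 0 ≤ b → weightTrace (X p) (fun b => (τ b).re) b ≠ ⊤ :=
    fun p b hb => ne_top_of_le_ne_top ENNReal.ofReal_ne_top (hle p b hb)
  have hbound : ∃ C : ℝ, ∀ b : A, 0 ≤ b →
      (weightTrace (X q) (fun b => (τ b).re) b).toReal ≤ C * ‖b‖ := by
    obtain ⟨C, hC⟩ := hw.bound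
    have hcq : 0 < N q ^ (-β) := Real.rpow_pos_of_pos (hN q) _
    refine ⟨(N q ^ (-β))⁻¹ * C, fun b hb => ?_⟩
    refine (ENNReal.toReal_le_of_le_ofReal
      (mul_nonneg (by positivity) (hw.nonneg b hb)) (hle q b hb)).trans ?_
    rw [_root_.mul_assoc]
    gcongr
    exact hC b hb
  have heq := (Y.isTensor (rfl : x * q = x * q) hx).weightTrace_eq (Y.lact_mul_eq rfl) hw
    (hfin q) hbound ha
  have hσ : IsTraceWeight fun b => (weightTrace (X q) (fun b => (τ b).re) b).toReal :=
    hw.weightTrace (hfin q) hbound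
  have hlim := (hσ.tendsto_weightTrace (E := X x) ha (heq ▸ hfin (x * q) a ha)).const_mul
    (N x ^ (-β) * N q ^ (-β))
  rw [← heq] at hlim
  have hval : scaledTrace X N β τ (x * q) a = N x ^ (-β) * N q ^ (-β) *
      (weightTrace (X (x * q)) (fun b => (τ b).re) a).toReal := by
    rw [scaledTrace, map_mul, Real.mul_rpow (hN x).le (hN q).le]
  rw [hval]
  refine hlim.congr fun H => ?_
  simp only [scaledTrace]
  rw [← Finset.mul_sum, _root_.mul_assoc]

theorem ProductSystem.exists_filter_tendsto_idealTrace [IsLeftCancelMul M]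
    (Y : ProductSystem A X) (hunit : ∀ u : M, IsUnit u → u = 1) (hN : ∀ p, 0 < N p)
    (hτ : IsTracialState τ)
    (hle : ∀ (p : M) (a : A), 0 ≤ a →
      weightTrace (X p) (fun b => (τ b).re) a ≤ ENNReal.ofReal ((N p ^ (-β))⁻¹ * (τ a).re))
    {x : M} (hx : x ≠ 1) (b : {a : A // 0 ≤ a}) :
    ∃ l : Filter (({a : A // 0 ≤ a} → ℝ) →ₗ[ℝ] ℝ), l.NeBot ∧
      (∀ᶠ T in l, ∀ g : {a : A // 0 ≤ a} → ℝ, 0 ≤ g → 0 ≤ T g) ∧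
      ∀ S, Tendsto (fun T : ({a : A // 0 ≤ a} → ℝ) →ₗ[ℝ] ℝ =>
        T fun b' => idealTrace X N β τ b'.1 S) l
          (𝓝 (idealTrace X N β τ b.1 ((x * ·) '' S))) := by
  have hinj := rightMultiples_injective hunit
  let T : Finset (X x) → ({a : A // 0 ≤ a} → ℝ) →ₗ[ℝ] ℝ := fun H =>
    (N x ^ (-β)) • ∑ ξ ∈ H, LinearMap.proj ⟨ip ξ (lact b.1 ξ), ip_lact_nonneg b.2 ξ⟩
  have hT : ∀ H g, T H g =
      N x ^ (-β) * ∑ ξ ∈ H, g ⟨ip ξ (lact b.1 ξ), ip_lact_nonneg b.2 ξ⟩ := fun H g => by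
    simp [T, LinearMap.sum_apply]
  refine ⟨map T (frameFilter A (X x)), inferInstance, ?_, fun S => ?_⟩
  · refine eventually_map.2 (Eventually.of_forall fun H g hg => ?_)
    rw [hT]
    exact mul_nonneg (Real.rpow_nonneg (hN x).le _) (Finset.sum_nonneg fun ξ _ => hg _)
  · rw [tendsto_map'_iff]
    by_cases hS : ∃ r, S = rightMultiples r
    · obtain ⟨r, rfl⟩ := hS
      rw [image_rightMultiples, idealTrace_rightMultiples X N β τ hinj]
      refine (Y.tendsto_scaledTrace hN hτ hle hx r b.2).congr fun H => ?_
      simp only [Function.comp_apply, hT, idealTrace_rightMultiples X N β τ hinj]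
    · have hS' : ¬ ∃ r, (x * ·) '' S = rightMultiples r := by
        rintro ⟨t, ht⟩
        obtain ⟨r, -, hr⟩ : t ∈ (x * ·) '' S := ht ▸ (dvd_refl t : t ∈ rightMultiples t)
        refine hS ⟨r, (mul_right_injective x).image_injective ?_⟩
        simp only [image_rightMultiples]
        rw [ht, ← hr]
      rw [idealTrace, dif_neg hS']
      refine tendsto_const_nhds.congr fun H => ?_
      simp [hT, idealTrace, dif_neg hS]

end Positivity

theorem IsWeakQuasiLatticeOrdered.eq_one_of_isUnit {G : Type*} [Group G] {P : Submonoid G}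
    (hP : IsWeakQuasiLatticeOrdered P) (u : P) (hu : IsUnit u) : u = 1 := by
  obtain ⟨v, rfl⟩ := hu
  have h : ((v : P) : G)⁻¹ = ((v⁻¹ : Pˣ) : P) := by
    refine inv_eq_of_mul_eq_one_right ?_
    rw [← Submonoid.coe_mul, v.mul_inv, Submonoid.coe_one]
  exact Subtype.ext (hP.inter_inv _ (v : P).2 (h ▸ ((v⁻¹ : Pˣ) : P).2))

theorem mainTheorem5 {G : Type*} [Group G] (P : Submonoid G)
    (hP : IsWeakQuasiLatticeOrdered P) (hNoeth : IsNoetherianMonoid P)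
    {A : Type*} [NonUnitalCStarAlgebra A] [PartialOrder A] [StarOrderedRing A]
    (X : P → Type*) [∀ p, NormedAddCommGroup (X p)] [∀ p, NormedSpace ℂ (X p)]
    [∀ p, CompleteSpace (X p)] [∀ p, CStarCorrespondence A (X p)]
    (Y : ProductSystem A X) (hess : ∀ p, IsEssential A (X p)) (hca : Y.IsCompactlyAligned)
    (N : P →* ℝ) (hN : ∀ p, 0 < N p) (β : ℝ)
    (τ : A →L[ℂ] ℂ) (hτ : IsTracialState τ) :
    PositivityOn X N β τ {p : P | p ≠ 1} ↔ PositivityOn X N β τ (PInf P) := by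
  have hunit := hP.eq_one_of_isUnit
  have hinj := rightMultiples_injective hunit
  have hw := hτ.isTraceWeight
  have hmem : ∀ {R : Set P}, PositivityOn X N β τ R → ∀ p ∈ R, ∀ a : A, 0 ≤ a →
      weightTrace (X p) (fun b => (τ b).re) a ≤ ENNReal.ofReal ((N p ^ (-β))⁻¹ * (τ a).re) :=
    fun h p hp a ha =>
      weightTrace_le_of_positivitySum hinj hN (h {p} (by simpa using hp) a ha)
  have hone : ∀ a : A, 0 ≤ a →
      weightTrace (X 1) (fun b => (τ b).re) a = ENNReal.ofReal (τ a).re :=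
    fun a ha => Y.weightTrace_one hτ ha
  constructor
  · intro h J _ a ha
    by_cases hJ : (1 : P) ∈ J
    · have hfin : ∀ p, weightTrace (X p) (fun b => (τ b).re) a ≠ ⊤ := fun p => by
        by_cases hp : p = 1
        · rw [hp, hone a ha]
          exact ENNReal.ofReal_ne_top
        · exact ne_top_of_le_ne_top ENNReal.ofReal_ne_top (hmem h p hp a ha)
      rw [positivitySum_eq_inclusionExclusion hinj hN hfin (hone a ha) (hw.nonneg a ha),
        inclusionExclusion_eq_zero_of_one_mem _ hJ, EReal.coe_zero]
    · exact h J (fun p hp h1 => hJ (h1 ▸ hp)) a ha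
  · intro h J _ a ha
    have hle := Y.weightTrace_le_of_irreducible hNoeth hunit hN hτ
      fun x hx => hmem h x (MemPInf.atom x hx)
    have hsum : ∀ (J : Finset P) (b : A), 0 ≤ b → positivitySum X N β τ J b =
        (inclusionExclusion (idealTrace X N β τ b) J Set.univ : ℝ) := fun J b hb =>
      positivitySum_eq_inclusionExclusion hinj hN
        (fun p => ne_top_of_le_ne_top ENNReal.ofReal_ne_top (hle p b hb)) (hone b hb)
        (hw.nonneg b hb) J
    rw [hsum J a ha, EReal.coe_nonneg]
    refine inclusionExclusion_nonneg_of_PInf hP.exists_lcm hunit hNoeth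
      (φ := fun b : {a : A // 0 ≤ a} => idealTrace X N β τ b.1)
      (fun b => idealTrace_empty X N β τ b.1) (fun x hx b => ?_) (fun K hK b => ?_) J ⟨a, ha⟩
    · exact Y.exists_filter_tendsto_idealTrace hunit hN hτ hle
        (fun h1 : x = 1 => hx.not_isUnit (h1 ▸ isUnit_one)) b
    · have h1 := h K hK b.1 b.2
      rwa [hsum K b.1 b.2, EReal.coe_nonneg] at h1
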